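/- Let $\mathcal X,\mathcal S,\mathcal Y$ be alphabets (nonempty standard Borel spaces, e.g. finite or countable sets or $\mathbb R^d$). Let $\mathbf W=\{W^n\}_{n\ge1}$ be a general channel, i.e. an arbitrary sequence of Markov kernels $W^n:\mathcal X^n\times\mathcal S^n\to\mathcal Y^n$, and let $\mathbf S\sim\{P_{S^n}\}_{n\ge1}$ be a general state, i.e. an arbitrary sequence of probability distributions $P_{S^n}$ on $\mathcal S^n$. An $(n,M,M_{\mathrm d})$ code with coded state information at the decoder consists of a state encoder $f_{\mathrm d}:\mathcal S^n\to[1:M_{\mathrm d}]$, a (possibly randomized) encoder $f:[1:M]\times\mathcal S^n\to\mathcal X^n$ and a decoder $\varphi:\mathcal Y^n\times[1:M_{\mathrm d}]\to[1:M]$. Its average error probability is $\mathbb P(\varphi(Y^n,f_{\mathrm d}(S^n))\ne m)$, where the message $m$ is uniform on $[1:M]$ and independent of $S^n\sim P_{S^n}$, and $Y^n\sim W^n(\cdot\mid f(m,S^n),S^n)$. A pair $(R,R_{\mathrm d})$ of nonnegative real numbers is achievable if there is a sequence of $(n,M_n,M_{\mathrm d,n})$ codes with average error probability tending to $0$, $$\liminf_{n\to\infty}\tfrac1n\log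 M_n\ge R\quad\text{and}\quad \limsup_{n\to\infty}\tfrac1n\log M_{\mathrm d,n}\le R_{\mathrm d}.$$ The capacity region $\mathscr C$ is the set of all achievable pairs. For random variables $Z_n$ put $\operatorname{p\text{-}limsup} Z_n=\inf\{\alpha\in\mathbb R:\lim_n\mathbb P(Z_n>\alpha)=0\}$ and $\operatorname{p\text{-}liminf}Z_n=-\operatorname{p\text{-}limsup}(-Z_n)$, both in $[-\infty,\infty]$. For processes $\mathbf A=\{A^n\}$, $\mathbf B=\{B^n\}$, $\mathbf C=\{C^n\}$ let $\overline I(\mathbf A;\mathbf B)$ and $\underline I(\mathbf A;\mathbf B)$ be the p-limsup and the p-liminf of $\frac1n\log\frac{P_{B^n|A^n}(B^n|A^n)}{P_{B^n}(B^n)}$, and let $\overline I(\mathbf A;\mathbf B|\mathbf C)$ and $\underline I(\mathbf A;\mathbf B|\mathbf C)$ be those of $\frac1n\log\frac{P_{B^n|A^n,C^n}(B^n|A^n,C^n)}{P_{B^n|C^n}(B^n|C^n)}$; the ratios are Radon-Nikodym derivatives, with the value $+\infty$ on the singular part. Theorem 2. $\mathscr C$ is the set of pairs $(R,R_{\mathrm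 d})$ of nonnegative real numbers satisfying $$R\le\underline I(\mathbf U;\mathbf Y|\mathbf V)-\overline I(\mathbf U;\mathbf S|\mathbf V),\qquad R_{\mathrm d}\ge\overline I(\mathbf V;\mathbf S)-\underline I(\mathbf V;\mathbf Y)$$ for some processes $(\mathbf U,\mathbf V,\mathbf X,\mathbf S,\mathbf Y)=\{U^n,V^n,X^n,S^n,Y^n\}_{n\ge1}$, with $U^n\in\mathcal U^n$ and $V^n\in\mathcal V^n$ for some standard Borel alphabets $\mathcal U,\mathcal V$, such that $(U^n,V^n)-(X^n,S^n)-Y^n$ is a Markov chain for every $n$, $S^n$ has distribution $P_{S^n}$, and the conditional distribution of $Y^n$ given $(X^n,S^n)$ is $W^n$. Here a difference of the form $\infty-\infty$ is undefined, and an inequality containing it does not hold. -/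

import Mathlib

open MeasureTheory ProbabilityTheory Filter Topology
open scoped ENNReal

noncomputable section

namespace GelfandPinsker

/-- Vectors of length `n` over the alphabet `A`. -/
abbrev Vec (A : Type*) (n : ℕ) : Type _ := Fin n → A

/-! ### Limits in probability -/

/-- The limsup in probability, `inf {α : lim P(Z_n > α) = 0}`, of a sequence of (extended)
real-valued random variables, the `n`-th one living on `(Ω n, μ n)`. -/
def pLimsup {Ω : ℕ → Type*} [∀ n, MeasurableSpace (Ω n)] (μ : ∀ n, Measure (Ω n))
    (Z : ∀ n, Ω n → EReal) : EReal :=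
  ⨅ (α : ℝ) (_ : Tendsto (fun n => μ n {ω | (α : EReal) < Z n ω}) atTop (𝓝 0)), (α : EReal)

/-- The liminf in probability. -/
def pLiminf {Ω : ℕ → Type*} [∀ n, MeasurableSpace (Ω n)] (μ : ∀ n, Measure (Ω n))
    (Z : ∀ n, Ω n → EReal) : EReal :=
  - pLimsup μ (fun n ω => - Z n ω)

/-! ### Information densities -/

/-- The log-likelihood ratio `log (dP/dQ)` of two probability measures, with the value `+∞` on the
part of `P` that is singular to `Q` (the densities are taken with respect to the dominating
measure `P + Q`). It is determined `P`-almost everywhere; if `P` and `Q` have mass functions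
`p` and `q`, it is `log (p/q)`. -/
def logRatio {α : Type*} [MeasurableSpace α] (P Q : Measure α) (a : α) : EReal :=
  ENNReal.log (P.rnDeriv (P + Q) a / Q.rnDeriv (P + Q) a)

/-- The information density `log (P_{B|A}(B|A) / P_B(B))`, that is, the log-likelihood ratio of
`P_{A,B}` and `P_A × P_B` evaluated at `(A, B)`. -/
def infoDensity {Ω α β : Type*} [MeasurableSpace Ω] [MeasurableSpace α] [MeasurableSpace β]
    (μ : Measure Ω) (A : Ω → α) (B : Ω → β) (ω : Ω) : EReal :=
  logRatio (μ.map fun ω' => (A ω', B ω')) ((μ.map A).prod (μ.map B)) (A ω, B ω)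

/-- The conditional information density `log (P_{B|A,C}(B|A,C) / P_{B|C}(B|C))`, that is, the
log-likelihood ratio of `P_{A,C,B}` and `P_{A,C} ∘ P_{B|C}` evaluated at `(A, C, B)`. -/
def condInfoDensity {Ω α β γ : Type*} [MeasurableSpace Ω] [MeasurableSpace α]
    [MeasurableSpace β] [StandardBorelSpace β] [Nonempty β] [MeasurableSpace γ]
    (μ : Measure Ω) [IsFiniteMeasure μ] (A : Ω → α) (B : Ω → β) (C : Ω → γ) (ω : Ω) : EReal :=
  logRatio (μ.map fun ω' => ((A ω', C ω'), B ω'))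
    ((μ.map fun ω' => (A ω', C ω')) ⊗ₘ (Kernel.prodMkLeft α (condDistrib B C μ)))
    ((A ω, C ω), B ω)

/-! ### Spectral information rates -/

section Rates

variable {Ω α β γ : ℕ → Type*} [∀ n, MeasurableSpace (Ω n)] [∀ n, MeasurableSpace (α n)]
  [∀ n, MeasurableSpace (β n)] [∀ n, MeasurableSpace (γ n)]

/-- The spectral sup-mutual information rate. -/
def supInfo (μ : ∀ n, Measure (Ω n)) (A : ∀ n, Ω n → α n) (B : ∀ n, Ω n → β n) : EReal :=
  pLimsup μ fun n ω => (((n : ℝ)⁻¹ : ℝ) : EReal) * infoDensity (μ n) (A n) (B n) ω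

/-- The spectral inf-mutual information rate. -/
def infInfo (μ : ∀ n, Measure (Ω n)) (A : ∀ n, Ω n → α n) (B : ∀ n, Ω n → β n) : EReal :=
  pLiminf μ fun n ω => (((n : ℝ)⁻¹ : ℝ) : EReal) * infoDensity (μ n) (A n) (B n) ω

variable [∀ n, StandardBorelSpace (β n)] [∀ n, Nonempty (β n)]

/-- The spectral sup-conditional mutual information rate of `A` and `B` given `C`. -/
def supCondInfo (μ : ∀ n, Measure (Ω n)) [∀ n, IsFiniteMeasure (μ n)] (A : ∀ n, Ω n → α n)
    (B : ∀ n, Ω n → β n) (C : ∀ n, Ω n → γ n) : EReal :=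
  pLimsup μ fun n ω => (((n : ℝ)⁻¹ : ℝ) : EReal) * condInfoDensity (μ n) (A n) (B n) (C n) ω

/-- The spectral inf-conditional mutual information rate of `A` and `B` given `C`. -/
def infCondInfo (μ : ∀ n, Measure (Ω n)) [∀ n, IsFiniteMeasure (μ n)] (A : ∀ n, Ω n → α n)
    (B : ∀ n, Ω n → β n) (C : ∀ n, Ω n → γ n) : EReal :=
  pLiminf μ fun n ω => (((n : ℝ)⁻¹ : ℝ) : EReal) * condInfoDensity (μ n) (A n) (B n) (C n) ω

end Rates

/-! ### Codes and the capacity region -/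

/-- A code of block length `n` with `M` messages and `Md` state descriptions: a state encoder,
a possibly randomized encoder, and a decoder. -/
structure Code (X S Y : Type*) [MeasurableSpace X] [MeasurableSpace S] [MeasurableSpace Y]
    (n M Md : ℕ) where
  stateEnc : Vec S n → Fin Md
  measurable_stateEnc : Measurable stateEnc
  enc : Kernel (Fin M × Vec S n) (Vec X n)
  isMarkovKernel_enc : IsMarkovKernel enc
  dec : Vec Y n × Fin Md → Fin M
  measurable_dec : Measurable dec

variable {X S Y : Type*} [MeasurableSpace X] [MeasurableSpace S] [MeasurableSpace Y]

/-- The average error probability of a code over the channel `W` with state distribution `P`;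
the message is uniform and independent of the state. -/
def Code.errorProb {n M Md : ℕ} (c : Code X S Y n M Md) (W : Kernel (Vec X n × Vec S n) (Vec Y n))
    (P : Measure (Vec S n)) : ℝ≥0∞ :=
  (M : ℝ≥0∞)⁻¹ * ∑ m : Fin M, ∫⁻ s, ∫⁻ x, W (x, s) {y | c.dec (y, c.stateEnc s) ≠ m}
    ∂(c.enc (m, s)) ∂P

/-- A pair of nonnegative rates `(R, Rd)` is achievable if there are codes with vanishing average
error probability, message rate asymptotically at least `R` and state description rate
asymptotically at most `Rd`. -/
def IsAchievable (W : ∀ n, Kernel (Vec X n × Vec S n) (Vec Y n)) (P : ∀ n, Measure (Vec S n))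
    (R Rd : ℝ) : Prop :=
  0 ≤ R ∧ 0 ≤ Rd ∧ ∃ (M Md : ℕ → ℕ) (c : ∀ n, Code X S Y n (M n) (Md n)),
    (∀ n, 1 ≤ M n) ∧ (∀ n, 1 ≤ Md n) ∧
    (R : EReal) ≤ liminf (fun n : ℕ => (((n : ℝ)⁻¹ * Real.log (M n) : ℝ) : EReal)) atTop ∧
    limsup (fun n : ℕ => (((n : ℝ)⁻¹ * Real.log (Md n) : ℝ) : EReal)) atTop ≤ (Rd : EReal) ∧
    Tendsto (fun n => (c n).errorProb (W n) (P n)) atTop (𝓝 0)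

/-- The capacity region. -/
def capacityRegion (W : ∀ n, Kernel (Vec X n × Vec S n) (Vec Y n)) (P : ∀ n, Measure (Vec S n)) :
    Set (ℝ × ℝ) :=
  {r | IsAchievable W P r.1 r.2}

/-! ### The information-spectrum region -/

/-- The sample space of `(U^n, V^n, X^n, S^n, Y^n)`, grouped as `(((U,V), (X,S)), Y)`. -/
abbrev Joint (𝒰 𝒱 X S Y : Type*) (n : ℕ) : Type _ :=
  ((Vec 𝒰 n × Vec 𝒱 n) × (Vec X n × Vec S n)) × Vec Y n

/-- The laws of processes `(U, V, X, S, Y)` such that the state has the distribution `P` and,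
for every `n`, the conditional law of `Y^n` given `(U^n, V^n, X^n, S^n)` is `W^n(· | X^n, S^n)`;
that is, `(U, V) - (X, S) - Y` is a Markov chain in which the conditional law of `Y` given
`(X, S)` is the channel `W`. -/
structure AuxProcess (𝒰 𝒱 : Type*) [MeasurableSpace 𝒰] [MeasurableSpace 𝒱]
    (W : ∀ n, Kernel (Vec X n × Vec S n) (Vec Y n)) (P : ∀ n, Measure (Vec S n)) where
  law : ∀ n, Measure (Joint 𝒰 𝒱 X S Y n)
  isProb : ∀ n, IsProbabilityMeasure (law n)
  state_law : ∀ n, (law n).map (fun ω => ω.1.2.2) = P n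
  markov : ∀ n, law n = (law n).fst ⊗ₘ (Kernel.prodMkLeft (Vec 𝒰 n × Vec 𝒱 n) (W n))

namespace AuxProcess

variable {𝒰 𝒱 : Type*} [MeasurableSpace 𝒰] [MeasurableSpace 𝒱]
  {W : ∀ n, Kernel (Vec X n × Vec S n) (Vec Y n)} {P : ∀ n, Measure (Vec S n)}

instance (Q : AuxProcess 𝒰 𝒱 W P) (n : ℕ) : IsProbabilityMeasure (Q.law n) := Q.isProb n

/-- The process `U`. -/
def procU (_ : AuxProcess 𝒰 𝒱 W P) (n : ℕ) (ω : Joint 𝒰 𝒱 X S Y n) : Vec 𝒰 n := ω.1.1.1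

/-- The process `V`. -/
def procV (_ : AuxProcess 𝒰 𝒱 W P) (n : ℕ) (ω : Joint 𝒰 𝒱 X S Y n) : Vec 𝒱 n := ω.1.1.2

/-- The process `S`. -/
def procS (_ : AuxProcess 𝒰 𝒱 W P) (n : ℕ) (ω : Joint 𝒰 𝒱 X S Y n) : Vec S n := ω.1.2.2

/-- The process `Y`. -/
def procY (_ : AuxProcess 𝒰 𝒱 W P) (n : ℕ) (ω : Joint 𝒰 𝒱 X S Y n) : Vec Y n := ω.2

end AuxProcess

/-- The pairs of nonnegative numbers `(R, Rd)` with `R ≤ I_(U;Y|V) - Ī(U;S|V)` and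
`Rd ≥ Ī(V;S) - I_(V;Y)` for some processes as above. The rates are extended real numbers; a
difference `∞ - ∞` is undefined and satisfies no inequality. The two conditions `≠ ⊤` exclude only
this case (if just the subtrahend of the first or the minuend of the second difference is
infinite, the inequality fails anyway). -/
def infoRegion [StandardBorelSpace S] [Nonempty S] [StandardBorelSpace Y] [Nonempty Y]
    (W : ∀ n, Kernel (Vec X n × Vec S n) (Vec Y n)) (P : ∀ n, Measure (Vec S n)) :
    Set (ℝ × ℝ) :=
  {r | 0 ≤ r.1 ∧ 0 ≤ r.2 ∧
    ∃ (𝒰 𝒱 : Type) (_ : MeasurableSpace 𝒰) (_ : StandardBorelSpace 𝒰)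
      (_ : MeasurableSpace 𝒱) (_ : StandardBorelSpace 𝒱) (Q : AuxProcess 𝒰 𝒱 W P),
      supCondInfo Q.law Q.procU Q.procS Q.procV ≠ ⊤ ∧
      supInfo Q.law Q.procV Q.procS ≠ ⊤ ∧
      (r.1 : EReal) ≤ infCondInfo Q.law Q.procU Q.procY Q.procV
        - supCondInfo Q.law Q.procU Q.procS Q.procV ∧
      supInfo Q.law Q.procV Q.procS - infInfo Q.law Q.procV Q.procY ≤ (r.2 : EReal)}

end GelfandPinsker

end

open MeasureTheory ProbabilityTheory Filter Topology
open scoped ENNReal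

noncomputable section

namespace GelfandPinsker

/-! ### Selecting the first admissible index. -/

section Select

variable {ι : Type*} [Fintype ι] [LinearOrder ι] [Nonempty ι]

open Classical in
/-- The first index at which `p` holds; an arbitrary index if there is none. -/
def firstIdx (p : ι → Prop) : ι :=
  if h : (Finset.univ.filter p).Nonempty then (Finset.univ.filter p).min' h
  else Classical.arbitrary ι

lemma firstIdx_spec {p : ι → Prop} (h : ∃ i, p i) : p (firstIdx p) := by
  classical
  have hne : (Finset.univ.filter p).Nonempty := by
    obtain ⟨i, hi⟩ := h
    exact ⟨i, by simpa using hi⟩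
  have := Finset.min'_mem _ hne
  rw [firstIdx, dif_pos hne]
  simpa using this

lemma firstIdx_le {p : ι → Prop} {i : ι} (h : p i) : firstIdx p ≤ i := by
  classical
  have hi : i ∈ Finset.univ.filter p := by simpa using h
  rw [firstIdx, dif_pos ⟨i, hi⟩]
  exact Finset.min'_le _ _ hi

/-- Discarding an index other than the first one does not change the first index. -/
lemma firstIdx_and_ne {p : ι → Prop} (h : ∃ i, p i) {j : ι} (hj : j ≠ firstIdx p) :
    firstIdx (fun i => p i ∧ i ≠ j) = firstIdx p := by
  have h0 : p (firstIdx p) ∧ firstIdx p ≠ j := ⟨firstIdx_spec h, hj.symm⟩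
  refine le_antisymm (firstIdx_le (p := fun i => p i ∧ i ≠ j) h0) ?_
  exact firstIdx_le (firstIdx_spec (p := fun i => p i ∧ i ≠ j) ⟨_, h0⟩).1

lemma measurable_firstIdx [Countable ι] [MeasurableSpace ι] {α : Type*} [MeasurableSpace α]
    {p : α → ι → Prop} (hp : ∀ i, MeasurableSet {a | p a i}) :
    Measurable fun a => firstIdx (p a) := by
  have h1 : Measurable p := measurable_pi_lambda _ fun i => measurableSet_setOfPred.1 (hp i)
  exact (measurable_of_countable (firstIdx : (ι → Prop) → ι)).comp h1

end Select

/-! ### Integration and measurability tools. -/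

lemma lintegral_le_of_forall_le {α : Type*} [MeasurableSpace α] {μ : Measure α}
    [IsProbabilityMeasure μ] {f : α → ℝ≥0∞} {c : ℝ≥0∞} (h : ∀ a, f a ≤ c) : ∫⁻ a, f a ∂μ ≤ c :=
  (lintegral_mono h).trans (by simp)

/-- By Tonelli, coordinate `i` may be integrated first with all others frozen. In this way one
codeword is redrawn while the rest of the codebook stays fixed. -/
lemma lintegral_pi_le_of_forall_update {ι : Type*} [Fintype ι] [DecidableEq ι] {π : ι → Type*}
    [∀ i, MeasurableSpace (π i)] (μ : ∀ i, Measure (π i)) [∀ i, IsProbabilityMeasure (μ i)]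
    {f : (∀ i, π i) → ℝ≥0∞} (hf : Measurable f) (i : ι) {C : ℝ≥0∞}
    (h : ∀ x, ∫⁻ w, f (Function.update x i w) ∂(μ i) ≤ C) :
    ∫⁻ x, f x ∂(Measure.pi μ) ≤ C := by
  let x₀ : ∀ i, π i := fun i => (nonempty_of_isProbabilityMeasure (μ i)).some
  rw [lintegral_eq_lmarginal_univ x₀, lmarginal_erase' _ hf (Finset.mem_univ i)]
  calc _ ≤ (∫⋯∫⁻_(Finset.univ.erase i), (fun _ => C) ∂μ) x₀ := lmarginal_mono (fun x => h x) x₀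
    _ = C := by simp [lmarginal]

lemma measurable_kernel_section {α ζ 𝒴 : Type*} [MeasurableSpace α] [MeasurableSpace ζ]
    [MeasurableSpace 𝒴] (N : Kernel ζ 𝒴) [IsSFiniteKernel N] {z : α → ζ} (hz : Measurable z)
    {p : α → 𝒴 → Prop} (hp : MeasurableSet {a : α × 𝒴 | p a.1 a.2}) :
    Measurable fun a => N (z a) {y | p a y} :=
  Kernel.measurable_kernel_prodMk_left (κ := N.comap z hz) hp

lemma measurable_eval_index {α ι β : Type*} [MeasurableSpace α] [MeasurableSpace ι] [Countable ι]
    [MeasurableSingletonClass ι] [MeasurableSpace β]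
    {f : α → ι → β} (hf : Measurable f) {g : α → ι} (hg : Measurable g) :
    Measurable fun a => f a (g a) := by
  have : Measurable (fun q : (ι → β) × ι => q.1 q.2) :=
    measurable_from_prod_countable_left fun i => measurable_pi_apply i
  exact this.comp (hf.prodMk hg)

/-! ### The random codebook and its union bound. -/

section RandomCoding

set_option linter.unusedSectionVars false

variable {σ 𝒱 τ 𝒳 𝒴 : Type*} [MeasurableSpace σ] [MeasurableSpace 𝒱] [MeasurableSpace τ]
  [MeasurableSpace 𝒳] [MeasurableSpace 𝒴] {L K M B : ℕ} [NeZero L] [NeZero K] [NeZero M]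

/-- The first codeword that fits the state `s`. -/
def selV (A₁ : Set (σ × 𝒱)) (v : Fin L → 𝒱) (s : σ) : 𝒱 :=
  v (firstIdx fun l => (s, v l) ∈ A₁)

/-- The first satellite codeword for the message `m` that fits the state `s` and the codeword
`w`. -/
def selT (A₂ : Set ((σ × 𝒱) × τ)) (t : Fin M × Fin K → τ) (m : Fin M) (s : σ) (w : 𝒱) : τ :=
  t (m, firstIdx fun k => ((s, w), t (m, k)) ∈ A₂)

/-- The decoder: find the codeword in the given bin, then the message. -/
def decodeMsg (D₁ : Set (𝒱 × 𝒴)) (D₂ : Set ((𝒱 × τ) × 𝒴)) (β : 𝒱 → Fin B) (v : Fin L → 𝒱)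
    (t : Fin M × Fin K → τ) (y : 𝒴 × Fin B) : Fin M :=
  firstIdx fun m => ∃ k,
    ((v (firstIdx fun l => (v l, y.1) ∈ D₁ ∧ β (v l) = y.2), t (m, k)), y.1) ∈ D₂

lemma measurable_selV {α : Type*} [MeasurableSpace α] {A₁ : Set (σ × 𝒱)} (hA₁ : MeasurableSet A₁)
    {v : α → Fin L → 𝒱} (hv : Measurable v) {s : α → σ} (hs : Measurable s) :
    Measurable fun a => selV A₁ (v a) (s a) :=
  measurable_eval_index hv <| measurable_firstIdx fun l =>
    hA₁.preimage (hs.prodMk ((measurable_pi_apply l).comp hv))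

lemma measurable_selT {α : Type*} [MeasurableSpace α] {A₂ : Set ((σ × 𝒱) × τ)}
    (hA₂ : MeasurableSet A₂) {t : α → Fin M × Fin K → τ} (ht : Measurable t) {m : α → Fin M}
    (hm : Measurable m) {s : α → σ} (hs : Measurable s) {w : α → 𝒱} (hw : Measurable w) :
    Measurable fun a => selT A₂ (t a) (m a) (s a) (w a) :=
  measurable_eval_index ht <| hm.prodMk <| measurable_firstIdx fun _ =>
    hA₂.preimage ((hs.prodMk hw).prodMk (measurable_eval_index ht (hm.prodMk measurable_const)))

lemma measurable_decodeMsg {D₁ : Set (𝒱 × 𝒴)} (hD₁ : MeasurableSet D₁)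
    {D₂ : Set ((𝒱 × τ) × 𝒴)} (hD₂ : MeasurableSet D₂) {β : 𝒱 → Fin B} (v : Fin L → 𝒱)
    (t : Fin M × Fin K → τ) : Measurable (decodeMsg D₁ D₂ β v t) := by
  have h1 : Measurable fun y : 𝒴 × Fin B =>
      v (firstIdx fun l => (v l, y.1) ∈ D₁ ∧ β (v l) = y.2) := by
    refine measurable_eval_index measurable_const (measurable_firstIdx fun l => ?_)
    refine MeasurableSet.inter (hD₁.preimage (by fun_prop)) ?_
    exact measurableSet_eq_fun measurable_const measurable_snd
  refine measurable_firstIdx fun m => ?_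
  simp only [Set.ofPred_exists]
  exact MeasurableSet.iUnion fun k =>
    hD₂.preimage ((h1.prodMk measurable_const).prodMk measurable_fst)

open Classical in
/-- The indicator that no codeword fits the state. -/
def noFitV (A₁ : Set (σ × 𝒱)) (v : Fin L → 𝒱) (s : σ) : ℝ≥0∞ :=
  if ∀ l, (s, v l) ∉ A₁ then 1 else 0

open Classical in
/-- The indicator that no satellite codeword for the message `m` fits the state and `w`. -/
def noFitT (A₁ : Set (σ × 𝒱)) (A₂ : Set ((σ × 𝒱) × τ)) (m : Fin M) (t : Fin M × Fin K → τ) (s : σ)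
    (w : 𝒱) : ℝ≥0∞ :=
  if (s, w) ∈ A₁ ∧ ∀ k, ((s, w), t (m, k)) ∉ A₂ then 1 else 0

open Classical in
/-- The probability that the `l`-th codeword is in the right bin and matches the output although it
is not the selected one. -/
def wrongV (A₁ : Set (σ × 𝒱)) (A₂ : Set ((σ × 𝒱) × τ)) (D₁ : Set (𝒱 × 𝒴)) (β : 𝒱 → Fin B)
    (N : Kernel ((σ × 𝒱) × τ) 𝒴) (m : Fin M) (l : Fin L) (v : Fin L → 𝒱)
    (t : Fin M × Fin K → τ) (s : σ) : ℝ≥0∞ :=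
  if (∃ l, (s, v l) ∈ A₁) ∧ l ≠ firstIdx fun l => (s, v l) ∈ A₁ then
    N ((s, selV A₁ v s), selT A₂ t m s (selV A₁ v s))
      {y | (v l, y) ∈ D₁ ∧ β (v l) = β (selV A₁ v s)} else 0

/-- The probability that the `i`-th satellite codeword matches the output although it belongs to
another message. -/
def wrongT (A₂ : Set ((σ × 𝒱) × τ)) (D₂ : Set ((𝒱 × τ) × 𝒴)) (N : Kernel ((σ × 𝒱) × τ) 𝒴)
    (m : Fin M) (i : Fin M × Fin K) (t : Fin M × Fin K → τ) (s : σ) (w : 𝒱) : ℝ≥0∞ :=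
  if i.1 ≠ m then N ((s, w), selT A₂ t m s w) {y | ((w, t i), y) ∈ D₂} else 0

/-- The union bound on the decoding errors for a fixed codebook, message and state. -/
def codebookBound (A₁ : Set (σ × 𝒱)) (A₂ : Set ((σ × 𝒱) × τ)) (D₁ : Set (𝒱 × 𝒴))
    (D₂ : Set ((𝒱 × τ) × 𝒴)) (β : 𝒱 → Fin B) (N : Kernel ((σ × 𝒱) × τ) 𝒴) (δ : ℝ≥0∞)
    (m : Fin M) (v : Fin L → 𝒱) (t : Fin M × Fin K → τ) (s : σ) : ℝ≥0∞ :=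
  noFitV A₁ v s + noFitT A₁ A₂ m t s (selV A₁ v s) + δ
    + ∑ l, wrongV A₁ A₂ D₁ β N m l v t s + ∑ i, wrongT A₂ D₂ N m i t s (selV A₁ v s)

/-- If nothing fits in one of the layers, one of the first two terms equals 1. Otherwise the
selected triple lies in `A₂`, so the output passes both decoding tests for the true indices up to
probability `δ`. Both searches then succeed, and an error requires some other index to pass a test.
-/
lemma error_le_codebookBound (A₁ : Set (σ × 𝒱)) (A₂ : Set ((σ × 𝒱) × τ)) (D₁ : Set (𝒱 × 𝒴))
    (D₂ : Set ((𝒱 × τ) × 𝒴)) (β : 𝒱 → Fin B) (N : Kernel ((σ × 𝒱) × τ) 𝒴) [IsMarkovKernel N]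
    {δ : ℝ≥0∞}
    (hbad : ∀ z ∈ A₂, N z {y | (z.1.2, y) ∉ D₁ ∨ ((z.1.2, z.2), y) ∉ D₂} ≤ δ)
    (m : Fin M) (v : Fin L → 𝒱) (t : Fin M × Fin K → τ) (s : σ) :
    N ((s, selV A₁ v s), selT A₂ t m s (selV A₁ v s))
      {y | decodeMsg D₁ D₂ β v t (y, β (selV A₁ v s)) ≠ m}
      ≤ codebookBound A₁ A₂ D₁ D₂ β N δ m v t s := by
  classical
  unfold codebookBound
  set w := selV A₁ v s with hw
  set z := ((s, w), selT A₂ t m s w) with hz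
  by_cases h1 : ∃ l, (s, v l) ∈ A₁
  swap
  · have : ∀ l, (s, v l) ∉ A₁ := by simpa using h1
    simp only [noFitV, if_pos this, add_assoc]
    exact prob_le_one.trans le_self_add
  have hwA : (s, w) ∈ A₁ := firstIdx_spec (p := fun l => (s, v l) ∈ A₁) h1
  by_cases h2 : ∃ k, ((s, w), t (m, k)) ∈ A₂
  swap
  · have : (s, w) ∈ A₁ ∧ ∀ k, ((s, w), t (m, k)) ∉ A₂ := ⟨hwA, by simpa using h2⟩
    simp only [noFitT, if_pos this, add_assoc]
    exact prob_le_one.trans (le_add_left le_self_add)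
  have hzA : z ∈ A₂ := firstIdx_spec (p := fun k => ((s, w), t (m, k)) ∈ A₂) h2
  have hsub : {y | decodeMsg D₁ D₂ β v t (y, β w) ≠ m} ⊆
      {y | (z.1.2, y) ∉ D₁ ∨ ((z.1.2, z.2), y) ∉ D₂}
      ∪ (⋃ l ∈ Finset.univ.filter (fun l => l ≠ firstIdx fun l => (s, v l) ∈ A₁),
          {y | (v l, y) ∈ D₁ ∧ β (v l) = β w})
      ∪ ⋃ i ∈ Finset.univ.filter (fun i : Fin M × Fin K => i.1 ≠ m), {y | ((w, t i), y) ∈ D₂} := by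
    intro y hy
    by_contra hcon
    simp only [Set.mem_union, Set.mem_ofPred_eq, Set.mem_iUnion, not_or, not_exists, not_not,
      Finset.mem_filter, Finset.mem_univ, true_and, exists_prop, not_and] at hcon
    obtain ⟨⟨⟨hy1, hy2⟩, hl⟩, hm⟩ := hcon
    apply hy
    have hl0 : (v (firstIdx fun l => (v l, y) ∈ D₁ ∧ β (v l) = β w)) = w := by
      have hspec := firstIdx_spec (p := fun l => (v l, y) ∈ D₁ ∧ β (v l) = β w)
        ⟨firstIdx fun l => (s, v l) ∈ A₁, hy1, rfl⟩
      by_contra hne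
      refine hl _ (fun h => hne ?_) hspec.1 hspec.2
      rw [h]; rfl
    have hex : ∃ m' : Fin M, ∃ k, ((w, t (m', k)), y) ∈ D₂ := ⟨m, _, hy2⟩
    have hdec : decodeMsg D₁ D₂ β v t (y, β w)
        = firstIdx fun m => ∃ k, ((w, t (m, k)), y) ∈ D₂ := by
      simp only [decodeMsg, hl0]
    obtain ⟨k, hk⟩ := firstIdx_spec hex
    by_contra hne
    exact hm (_, k) (by rw [← hdec]; exact hne) hk
  refine (measure_mono hsub).trans ?_
  refine (measure_union_le _ _).trans ?_
  refine add_le_add ((measure_union_le _ _).trans (add_le_add ?_ ?_)) ?_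
  · exact (hbad z hzA).trans le_add_self
  · refine (measure_biUnion_finset_le _ _).trans ?_
    rw [Finset.sum_filter]
    refine Finset.sum_le_sum fun l _ => ?_
    by_cases hl : l ≠ firstIdx fun l => (s, v l) ∈ A₁
    · rw [if_pos hl, wrongV, if_pos ⟨h1, hl⟩]
    · rw [if_neg hl]
      exact zero_le
  · refine (measure_biUnion_finset_le _ _).trans ?_
    rw [Finset.sum_filter]
    exact le_rfl

section Measurability

variable {α : Type*} [MeasurableSpace α] {A₁ : Set (σ × 𝒱)} {A₂ : Set ((σ × 𝒱) × τ)}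
  {D₁ : Set (𝒱 × 𝒴)} {D₂ : Set ((𝒱 × τ) × 𝒴)} {β : 𝒱 → Fin B} {v : α → Fin L → 𝒱}
  {t : α → Fin M × Fin K → τ} {s : α → σ}

lemma measurable_noFitV (hA₁ : MeasurableSet A₁) (hv : Measurable v) (hs : Measurable s) :
    Measurable fun a => noFitV A₁ (v a) (s a) := by
  refine Measurable.ite ?_ measurable_const measurable_const
  rw [Set.ofPred_forall]
  exact MeasurableSet.iInter fun l =>
    (hA₁.preimage (hs.prodMk ((measurable_pi_apply l).comp hv))).compl

lemma measurable_noFitT (hA₁ : MeasurableSet A₁) (hA₂ : MeasurableSet A₂) (m : Fin M)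
    (ht : Measurable t) (hs : Measurable s) {w : α → 𝒱} (hw : Measurable w) :
    Measurable fun a => noFitT A₁ A₂ m (t a) (s a) (w a) := by
  refine Measurable.ite ?_ measurable_const measurable_const
  refine MeasurableSet.inter (hA₁.preimage (hs.prodMk hw)) ?_
  change MeasurableSet {a | ∀ k, ((s a, w a), t a (m, k)) ∉ A₂}
  rw [Set.ofPred_forall]
  exact MeasurableSet.iInter fun k =>
    (hA₂.preimage ((hs.prodMk hw).prodMk ((measurable_pi_apply (m, k)).comp ht))).compl

lemma measurable_wrongV (hA₁ : MeasurableSet A₁) (hA₂ : MeasurableSet A₂) (hD₁ : MeasurableSet D₁)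
    (hβ : Measurable β) (N : Kernel ((σ × 𝒱) × τ) 𝒴) [IsMarkovKernel N] (m : Fin M) (l : Fin L)
    (hv : Measurable v) (ht : Measurable t) (hs : Measurable s) :
    Measurable fun a => wrongV A₁ A₂ D₁ β N m l (v a) (t a) (s a) := by
  have hw := measurable_selV hA₁ hv hs
  have hz := (hs.prodMk hw).prodMk (measurable_selT hA₂ ht (measurable_const (a := m)) hs hw)
  have hvl (l : Fin L) : Measurable fun a => v a l := (measurable_pi_apply l).comp hv
  have hfit (l : Fin L) : MeasurableSet {a | (s a, v a l) ∈ A₁} :=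
    hA₁.preimage (hs.prodMk (hvl l))
  refine Measurable.ite ?_ ?_ measurable_const
  · refine MeasurableSet.inter ?_ ?_
    · change MeasurableSet {a | ∃ l, (s a, v a l) ∈ A₁}
      rw [Set.ofPred_exists]
      exact MeasurableSet.iUnion hfit
    · exact (measurableSet_eq_fun measurable_const (measurable_firstIdx hfit)).compl
  · refine measurable_kernel_section N hz
      (p := fun a y => (v a l, y) ∈ D₁ ∧ β (v a l) = β (selV A₁ (v a) (s a))) ?_
    refine MeasurableSet.inter
      (hD₁.preimage (((hvl l).comp measurable_fst).prodMk measurable_snd)) ?_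
    exact measurableSet_eq_fun (hβ.comp ((hvl l).comp measurable_fst))
      (hβ.comp (hw.comp measurable_fst))

lemma measurable_wrongT (hA₂ : MeasurableSet A₂) (hD₂ : MeasurableSet D₂)
    (N : Kernel ((σ × 𝒱) × τ) 𝒴) [IsMarkovKernel N] (m : Fin M) (i : Fin M × Fin K)
    (ht : Measurable t) (hs : Measurable s) {w : α → 𝒱} (hw : Measurable w) :
    Measurable fun a => wrongT A₂ D₂ N m i (t a) (s a) (w a) := by
  have hz := (hs.prodMk hw).prodMk (measurable_selT hA₂ ht (measurable_const (a := m)) hs hw)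
  unfold wrongT
  split_ifs
  · refine measurable_kernel_section N hz (p := fun a y => ((w a, t a i), y) ∈ D₂) ?_
    exact hD₂.preimage (((hw.comp measurable_fst).prodMk
      (((measurable_pi_apply i).comp ht).comp measurable_fst)).prodMk measurable_snd)
  · exact measurable_const

lemma measurable_codebookBound (hA₁ : MeasurableSet A₁) (hA₂ : MeasurableSet A₂)
    (hD₁ : MeasurableSet D₁) (hD₂ : MeasurableSet D₂) (hβ : Measurable β)
    (N : Kernel ((σ × 𝒱) × τ) 𝒴) [IsMarkovKernel N] (δ : ℝ≥0∞) (m : Fin M)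
    (hv : Measurable v) (ht : Measurable t) (hs : Measurable s) :
    Measurable fun a => codebookBound A₁ A₂ D₁ D₂ β N δ m (v a) (t a) (s a) := by
  have hw := measurable_selV hA₁ hv hs
  exact ((((measurable_noFitV hA₁ hv hs).add (measurable_noFitT hA₁ hA₂ m ht hs hw)).add
    measurable_const).add
    (Finset.measurable_fun_sum _ fun l _ => measurable_wrongV hA₁ hA₂ hD₁ hβ N m l hv ht hs)).add
    (Finset.measurable_fun_sum _ fun i _ => measurable_wrongT hA₂ hD₂ N m i ht hs hw)

end Measurability

/-! ### Averaging the union bound over codebooks. -/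

section Expectation

variable {A₁ : Set (σ × 𝒱)} {A₂ : Set ((σ × 𝒱) × τ)}
  {D₁ : Set (𝒱 × 𝒴)} {D₂ : Set ((𝒱 × τ) × 𝒴)} {β : 𝒱 → Fin B}

/-- Tonelli lets the output be drawn before the codeword, which is independent of it. -/
lemma lintegral_kernel_section_le {ν : Measure 𝒴} [IsProbabilityMeasure ν] {π : Measure τ}
    [IsProbabilityMeasure π] {E : Set (τ × 𝒴)} (hE : MeasurableSet E) {d : ℝ≥0∞}
    (h : ∀ y, π {w | (w, y) ∈ E} ≤ d) : ∫⁻ w, ν {y | (w, y) ∈ E} ∂π ≤ d := by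
  have h1 : ∫⁻ w, ν {y | (w, y) ∈ E} ∂π = (π.prod ν) E := (Measure.prod_apply hE).symm
  rw [h1, Measure.prod_apply_symm hE]
  exact lintegral_le_of_forall_le h

lemma lintegral_noFitV (hA₁ : MeasurableSet A₁) (pV : Measure 𝒱) [IsProbabilityMeasure pV] (s : σ) :
    ∫⁻ v : Fin L → 𝒱, noFitV A₁ v s ∂(Measure.pi fun _ => pV) = pV {w | (s, w) ∉ A₁} ^ L := by
  classical
  have hm : MeasurableSet {w | (s, w) ∉ A₁} := (hA₁.preimage measurable_prodMk_left).compl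
  have h1 : (fun v : Fin L → 𝒱 => noFitV A₁ v s)
      = (Set.univ.pi fun _ : Fin L => {w | (s, w) ∉ A₁}).indicator 1 := by
    ext v
    simp [noFitV, Set.indicator_apply]
  rw [h1, lintegral_indicator_one (MeasurableSet.univ_pi fun _ => hm), Measure.pi_pi]
  simp

/-- The event is a box whose sides are unrestricted at the indices of other messages, so only the
`K` factors of message `m` survive. -/
lemma lintegral_noFitT_le (hA₂ : MeasurableSet A₂) (pT : Measure τ)
    [IsProbabilityMeasure pT] (m : Fin M) (s : σ) (w : 𝒱) {ε : ℝ≥0∞}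
    (h : (s, w) ∈ A₁ → pT {x | ((s, w), x) ∉ A₂} ^ K ≤ ε) :
    ∫⁻ t : Fin M × Fin K → τ, noFitT A₁ A₂ m t s w ∂(Measure.pi fun _ => pT) ≤ ε := by
  classical
  by_cases hw : (s, w) ∈ A₁
  swap
  · simp [noFitT, hw]
  have hm : MeasurableSet {x | ((s, w), x) ∉ A₂} := (hA₂.preimage measurable_prodMk_left).compl
  have h1 : (fun t : Fin M × Fin K → τ => noFitT A₁ A₂ m t s w)
      = (Set.univ.pi fun i : Fin M × Fin K =>
          if i.1 = m then {x | ((s, w), x) ∉ A₂} else Set.univ).indicator 1 := by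
    ext t
    have : (∀ k, ((s, w), t (m, k)) ∉ A₂) ↔ t ∈ (Set.univ.pi fun i : Fin M × Fin K =>
          if i.1 = m then {x | ((s, w), x) ∉ A₂} else Set.univ) := by
      simp only [Set.mem_pi, Set.mem_univ, true_implies, Prod.forall]
      constructor
      · intro h a b
        split_ifs with hab
        · subst hab; exact h b
        · trivial
      · intro h k
        simpa using h m k
    simp only [noFitT, hw, true_and, Set.indicator_apply, this, Pi.one_apply]
  rw [h1, lintegral_indicator_one, Measure.pi_pi]
  · refine le_trans (le_of_eq ?_) (h hw)
    rw [Fintype.prod_prod_type, Finset.prod_eq_single m]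
    · simp
    · intro b _ hb
      simp [hb]
    · simp
  · refine MeasurableSet.univ_pi fun i => ?_
    split_ifs
    · exact hm
    · exact MeasurableSet.univ

/-- Since `l` is not selected, the selected codeword is the first fitting one among the others
(`firstIdx_and_ne`). Hence redrawing `v l` does not change the output law, and `v l` is an
independent draw tested against that output. -/
lemma lintegral_wrongV_le (hA₁ : MeasurableSet A₁) (hA₂ : MeasurableSet A₂)
    (hD₁ : MeasurableSet D₁) (hβ : Measurable β) (N : Kernel ((σ × 𝒱) × τ) 𝒴) [IsMarkovKernel N]
    (pV : Measure 𝒱) [IsProbabilityMeasure pV] (m : Fin M) (l : Fin L) (t : Fin M × Fin K → τ)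
    (s : σ) {d : ℝ≥0∞} (hd : ∀ y b, pV {w | (w, y) ∈ D₁ ∧ β w = b} ≤ d) :
    ∫⁻ v : Fin L → 𝒱, wrongV A₁ A₂ D₁ β N m l v t s ∂(Measure.pi fun _ => pV) ≤ d := by
  refine lintegral_pi_le_of_forall_update _ (measurable_wrongV hA₁ hA₂ hD₁ hβ N m l measurable_id
    measurable_const measurable_const) l fun v => ?_
  -- This condition does not involve the redrawn coordinate; where it fails, `l` can only be the
  -- selected index and `wrongV` vanishes.
  by_cases hex : ∃ i, (s, v i) ∈ A₁ ∧ i ≠ l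
  · set w₀ := v (firstIdx fun i => (s, v i) ∈ A₁ ∧ i ≠ l) with hw₀
    have hspec := firstIdx_spec hex
    calc ∫⁻ w, wrongV A₁ A₂ D₁ β N m l (Function.update v l w) t s ∂pV
        ≤ ∫⁻ w, N ((s, w₀), selT A₂ t m s w₀) {y | (w, y) ∈ {q | q ∈ D₁ ∧ β q.1 = β w₀}} ∂pV := by
          refine lintegral_mono fun w => ?_
          unfold wrongV
          split_ifs with hc
          · have hsel : selV A₁ (Function.update v l w) s = w₀ := by
              rw [selV, ← firstIdx_and_ne hc.1 hc.2]
              have : (fun i => (s, Function.update v l w i) ∈ A₁ ∧ i ≠ l)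
                  = fun i => (s, v i) ∈ A₁ ∧ i ≠ l := by
                ext i
                refine and_congr_left fun hi => ?_
                rw [Function.update_of_ne hi]
              rw [this, Function.update_of_ne hspec.2]
            rw [hsel, Function.update_self]
            exact le_rfl
          · exact zero_le
      _ ≤ d := by
          refine lintegral_kernel_section_le ?_ fun y => hd y (β w₀)
          exact hD₁.inter (measurableSet_eq_fun (hβ.comp measurable_fst) measurable_const)
  · have h0 : ∀ w, wrongV A₁ A₂ D₁ β N m l (Function.update v l w) t s = 0 := by
      intro w
      refine if_neg fun hc => hex
        ⟨firstIdx fun i => (s, Function.update v l w i) ∈ A₁, ?_, hc.2.symm⟩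
      have := firstIdx_spec hc.1
      rwa [Function.update_of_ne hc.2.symm] at this
    simp [h0]

/-- A satellite codeword of another message plays no role in the selection for `m`, so redrawing it
leaves the output law unchanged. -/
lemma lintegral_wrongT_le (hA₂ : MeasurableSet A₂) (hD₂ : MeasurableSet D₂)
    (N : Kernel ((σ × 𝒱) × τ) 𝒴) [IsMarkovKernel N] (pT : Measure τ) [IsProbabilityMeasure pT]
    (m : Fin M) (i : Fin M × Fin K) (s : σ) (w : 𝒱) {d : ℝ≥0∞}
    (hd : ∀ w y, pT {x | ((w, x), y) ∈ D₂} ≤ d) :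
    ∫⁻ t : Fin M × Fin K → τ, wrongT A₂ D₂ N m i t s w ∂(Measure.pi fun _ => pT)
      ≤ if i.1 ≠ m then d else 0 := by
  by_cases him : i.1 = m
  · simp [wrongT, him]
  rw [if_pos him]
  refine lintegral_pi_le_of_forall_update _ (measurable_wrongT hA₂ hD₂ N m i measurable_id
    measurable_const measurable_const) i fun t => ?_
  have hsel : ∀ x, selT A₂ (Function.update t i x) m s w = selT A₂ t m s w := by
    intro x
    have hne (k : Fin K) : (m, k) ≠ i := by
      rintro rfl
      exact him rfl
    simp only [selT, Function.update_of_ne (hne _)]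
  have h1 (x : τ) : wrongT A₂ D₂ N m i (Function.update t i x) s w
      = N ((s, w), selT A₂ t m s w) {y | ((w, x), y) ∈ D₂} := by
    rw [wrongT, if_pos him, hsel, Function.update_self]
  refine (lintegral_congr h1).trans_le ?_
  exact lintegral_kernel_section_le (π := pT) (E := {q : τ × 𝒴 | ((w, q.1), q.2) ∈ D₂})
    (hD₂.preimage (by fun_prop)) fun y => hd w y

/-- The two layers are independent, so each term may be integrated first over the layer that its
bound concerns: the codewords for `wrongV`, the satellites for `noFitT` and `wrongT`. The factor `M
- 1` counts the competing messages and makes the last term vanish for a single message. -/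
lemma lintegral_codebookBound_le (hA₁ : MeasurableSet A₁) (hA₂ : MeasurableSet A₂)
    (hD₁ : MeasurableSet D₁) (hD₂ : MeasurableSet D₂) (hβ : Measurable β)
    (N : Kernel ((σ × 𝒱) × τ) 𝒴) [IsMarkovKernel N] (pV : Measure 𝒱) [IsProbabilityMeasure pV]
    (pT : Measure τ) [IsProbabilityMeasure pT] (m : Fin M) (s : σ) {δ ε d₁ d₂ : ℝ≥0∞}
    (hfit : ∀ q ∈ A₁, pT {x | (q, x) ∉ A₂} ^ K ≤ ε)
    (hd₁ : ∀ y b, pV {w | (w, y) ∈ D₁ ∧ β w = b} ≤ d₁)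
    (hd₂ : ∀ w y, pT {x | ((w, x), y) ∈ D₂} ≤ d₂) :
    ∫⁻ c : (Fin L → 𝒱) × (Fin M × Fin K → τ), codebookBound A₁ A₂ D₁ D₂ β N δ m c.1 c.2 s
        ∂((Measure.pi fun _ => pV).prod (Measure.pi fun _ => pT))
      ≤ pV {w | (s, w) ∉ A₁} ^ L + ε + δ + L * d₁ + ((M - 1 : ℕ) * K : ℝ≥0∞) * d₂ := by
  have hv : Measurable fun c : (Fin L → 𝒱) × (Fin M × Fin K → τ) => c.1 := measurable_fst
  have ht : Measurable fun c : (Fin L → 𝒱) × (Fin M × Fin K → τ) => c.2 := measurable_snd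
  have hs : Measurable fun _ : (Fin L → 𝒱) × (Fin M × Fin K → τ) => s := measurable_const
  have hw := measurable_selV hA₁ hv hs
  have m0 := measurable_noFitV hA₁ hv hs
  have m1 := measurable_noFitT hA₁ hA₂ m ht hs hw
  have m3 (l : Fin L) := measurable_wrongV hA₁ hA₂ hD₁ hβ N m l hv ht hs
  have m4 (i : Fin M × Fin K) := measurable_wrongT hA₂ hD₂ N m i ht hs hw
  unfold codebookBound
  rw [lintegral_add_right _ (Finset.measurable_fun_sum _ fun i _ => m4 i),
    lintegral_add_right _ (Finset.measurable_fun_sum _ fun l _ => m3 l),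
    lintegral_add_right _ measurable_const, lintegral_add_right _ m1,
    lintegral_finsetSum _ fun i _ => m4 i, lintegral_finsetSum _ fun l _ => m3 l]
  refine add_le_add (add_le_add (add_le_add (add_le_add ?_ ?_) ?_) ?_) ?_
  · rw [lintegral_prod _ m0.aemeasurable]
    simp [lintegral_noFitV hA₁ pV s]
  · rw [lintegral_prod _ m1.aemeasurable]
    exact lintegral_le_of_forall_le fun v => lintegral_noFitT_le hA₂ pT m s (selV A₁ v s) (hfit _)
  · simp
  · calc _ ≤ ∑ _ : Fin L, d₁ := by
          refine Finset.sum_le_sum fun l _ => ?_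
          rw [lintegral_prod_symm _ (m3 l).aemeasurable]
          exact lintegral_le_of_forall_le fun t =>
            lintegral_wrongV_le hA₁ hA₂ hD₁ hβ N pV m l t s hd₁
      _ = L * d₁ := by simp
  · calc _ ≤ ∑ i : Fin M × Fin K, if i.1 ≠ m then d₂ else 0 := by
          refine Finset.sum_le_sum fun i _ => ?_
          rw [lintegral_prod _ (m4 i).aemeasurable]
          exact lintegral_le_of_forall_le fun v =>
            lintegral_wrongT_le hA₂ hD₂ N pT m i s (selV A₁ v s) hd₂
      _ = _ := by
          rw [Fintype.sum_prod_type]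
          have : ∀ x : Fin M, ∑ _ : Fin K, (if x ≠ m then d₂ else 0)
              = if x ≠ m then K * d₂ else 0 := by
            intro x; split_ifs <;> simp
          simp only [this]
          rw [← Finset.sum_filter, Finset.sum_const, Finset.filter_ne', Finset.card_erase_of_mem
            (Finset.mem_univ m)]
          simp [mul_assoc]

/-- **Random coding bound.** -/
theorem exists_code_of_sets (hA₁ : MeasurableSet A₁) (hA₂ : MeasurableSet A₂)
    (hD₁ : MeasurableSet D₁) (hD₂ : MeasurableSet D₂) (hβ : Measurable β)
    (N : Kernel ((σ × 𝒱) × τ) 𝒴) [IsMarkovKernel N] (κ : Kernel ((σ × 𝒱) × τ) 𝒳) [IsMarkovKernel κ]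
    (W : Kernel (𝒳 × σ) 𝒴)
    (hN : ∀ z E, MeasurableSet E → N z E = ∫⁻ x, W (x, z.1.1) E ∂(κ z))
    (pS : Measure σ) [IsProbabilityMeasure pS]
    (pV : Measure 𝒱) [IsProbabilityMeasure pV] (pT : Measure τ) [IsProbabilityMeasure pT]
    {δ ε₀ ε₁ ε₂ d₁ d₂ : ℝ≥0∞}
    (hbad : ∀ z ∈ A₂, N z {y | (z.1.2, y) ∉ D₁ ∨ ((z.1.2, z.2), y) ∉ D₂} ≤ δ)
    (hfit₁ : pS {s | ε₁ < pV {w | (s, w) ∉ A₁} ^ L} ≤ ε₀)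
    (hfit₂ : ∀ q ∈ A₁, pT {x | (q, x) ∉ A₂} ^ K ≤ ε₂)
    (hd₁ : ∀ y b, pV {w | (w, y) ∈ D₁ ∧ β w = b} ≤ d₁)
    (hd₂ : ∀ w y, pT {x | ((w, x), y) ∈ D₂} ≤ d₂) :
    ∃ (f : σ → Fin B) (e : Kernel (Fin M × σ) 𝒳) (φ : 𝒴 × Fin B → Fin M),
      Measurable f ∧ IsMarkovKernel e ∧ Measurable φ ∧
      (M : ℝ≥0∞)⁻¹ * ∑ m : Fin M, ∫⁻ s, ∫⁻ x, W (x, s) {y | φ (y, f s) ≠ m} ∂(e (m, s)) ∂pS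
        ≤ ε₀ + ε₁ + ε₂ + δ + L * d₁ + ((M - 1 : ℕ) * K : ℝ≥0∞) * d₂ := by
  let P : Measure ((Fin L → 𝒱) × (Fin M × Fin K → τ)) :=
    (Measure.pi fun _ => pV).prod (Measure.pi fun _ => pT)
  let G : (Fin L → 𝒱) × (Fin M × Fin K → τ) → ℝ≥0∞ := fun c => (M : ℝ≥0∞)⁻¹ * ∑ m : Fin M,
    ∫⁻ s, codebookBound A₁ A₂ D₁ D₂ β N δ m c.1 c.2 s ∂pS
  have hmeas (m : Fin M) : Measurable fun q : ((Fin L → 𝒱) × (Fin M × Fin K → τ)) × σ =>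
      codebookBound A₁ A₂ D₁ D₂ β N δ m q.1.1 q.1.2 q.2 :=
    measurable_codebookBound hA₁ hA₂ hD₁ hD₂ hβ N δ m (by fun_prop) (by fun_prop) (by fun_prop)
  have hG : Measurable G :=
    (Finset.measurable_fun_sum _ fun m _ => (hmeas m).lintegral_prod_right').const_mul _
  have hM : (M : ℝ≥0∞) ≠ 0 := by simpa using NeZero.ne M
  have hGle : ∫⁻ c, G c ∂P ≤ ε₀ + ε₁ + ε₂ + δ + L * d₁ + ((M - 1 : ℕ) * K : ℝ≥0∞) * d₂ := by
    have hm0 : Measurable fun s => pV {w | (s, w) ∉ A₁} :=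
      measurable_measure_prodMk_left (ν := pV) hA₁.compl
    have hsetm : MeasurableSet {s | ε₁ < pV {w | (s, w) ∉ A₁} ^ L} :=
      measurableSet_lt measurable_const (hm0.pow_const L)
    have h0 : ∫⁻ s, pV {w | (s, w) ∉ A₁} ^ L ∂pS ≤ ε₀ + ε₁ := by
      calc _ ≤ ∫⁻ s, ({s | ε₁ < pV {w | (s, w) ∉ A₁} ^ L}.indicator 1 s + ε₁) ∂pS := by
            refine lintegral_mono fun s => ?_
            by_cases hs : ε₁ < pV {w | (s, w) ∉ A₁} ^ L
            · rw [Set.indicator_of_mem (by exact hs)]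
              exact (pow_le_one₀ zero_le prob_le_one).trans le_self_add
            · exact (not_lt.1 hs).trans le_add_self
        _ ≤ ε₀ + ε₁ := by
            rw [lintegral_add_right _ measurable_const, lintegral_indicator_one hsetm]
            simpa using add_le_add_left hfit₁ ε₁
    have hone (m : Fin M) : ∫⁻ c, ∫⁻ s, codebookBound A₁ A₂ D₁ D₂ β N δ m c.1 c.2 s ∂pS ∂P
        ≤ ε₀ + ε₁ + ε₂ + δ + L * d₁ + ((M - 1 : ℕ) * K : ℝ≥0∞) * d₂ := by
      rw [lintegral_lintegral_swap (hmeas m).aemeasurable]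
      calc _ ≤ ∫⁻ s, (pV {w | (s, w) ∉ A₁} ^ L + (ε₂ + δ + L * d₁
              + ((M - 1 : ℕ) * K : ℝ≥0∞) * d₂)) ∂pS := by
            refine lintegral_mono fun s => ?_
            refine (lintegral_codebookBound_le hA₁ hA₂ hD₁ hD₂ hβ N pV pT m s hfit₂ hd₁
              hd₂).trans ?_
            simp only [add_assoc]
            exact le_rfl
        _ ≤ _ := by
            rw [lintegral_add_right _ measurable_const, lintegral_const, measure_univ, mul_one]
            refine (add_le_add_left h0 _).trans ?_
            simp only [add_assoc]
            exact le_rfl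
    rw [lintegral_const_mul _ (Finset.measurable_fun_sum _ fun m _ =>
      (hmeas m).lintegral_prod_right'), lintegral_finsetSum _ fun m _ =>
      (hmeas m).lintegral_prod_right']
    refine (mul_le_mul_right (Finset.sum_le_sum fun m _ => hone m) _).trans ?_
    rw [Finset.sum_const, Finset.card_univ, Fintype.card_fin, nsmul_eq_mul, ← mul_assoc,
      ENNReal.inv_mul_cancel hM (ENNReal.natCast_ne_top M), one_mul]
  -- Some codebook does at least as well as the average, for all messages and states averaged
  -- together.
  obtain ⟨⟨v, t⟩, hc⟩ := exists_le_lintegral (μ := P) hG.aemeasurable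
  have hsel : Measurable fun s => selV A₁ v s := measurable_selV hA₁ measurable_const measurable_id
  have hz : Measurable fun q : Fin M × σ =>
      ((q.2, selV A₁ v q.2), selT A₂ t q.1 q.2 (selV A₁ v q.2)) :=
    (measurable_snd.prodMk (hsel.comp measurable_snd)).prodMk
      (measurable_selT hA₂ measurable_const measurable_fst measurable_snd
        (hsel.comp measurable_snd))
  have hφ : Measurable (decodeMsg D₁ D₂ β v t) := measurable_decodeMsg hD₁ hD₂ v t
  -- Only the bin of the selected codeword is described; the encoder repeats the selection from the
  -- state itself.
  refine ⟨fun s => β (selV A₁ v s), κ.comap _ hz, decodeMsg D₁ D₂ β v t, hβ.comp hsel,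
    inferInstance, hφ, le_trans ?_ (hc.trans hGle)⟩
  refine mul_le_mul_right (Finset.sum_le_sum fun m _ => lintegral_mono fun s => ?_) _
  refine le_trans (le_of_eq ?_) (error_le_codebookBound A₁ A₂ D₁ D₂ β N hbad m v t s)
  rw [hN]
  · rfl
  · exact (measurableSet_eq_fun (hφ.comp (measurable_id.prodMk measurable_const))
      measurable_const).compl

end Expectation

end RandomCoding

/-! ### Change of measure by log-likelihood ratios. -/

section LogRatio

variable {α : Type*} [MeasurableSpace α] {P Q : Measure α}

lemma measurable_logRatio (P Q : Measure α) : Measurable (logRatio P Q) :=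
  ((Measure.measurable_rnDeriv _ _).div (Measure.measurable_rnDeriv _ _)).ennreal_log

lemma log_ofReal_exp (c : ℝ) : ENNReal.log (ENNReal.ofReal (Real.exp c)) = (c : EReal) := by
  rw [ENNReal.log_ofReal_of_pos (Real.exp_pos c), Real.log_exp]

/-- Change of measure where the likelihood ratio is at most `exp c`. -/
lemma measure_le_mul_of_logRatio_le [IsFiniteMeasure P] [IsFiniteMeasure Q] {c : ℝ} {B : Set α}
    (hB : MeasurableSet B) (h : ∀ a ∈ B, logRatio P Q a ≤ c) :
    P B ≤ ENNReal.ofReal (Real.exp c) * Q B := by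
  have hP : P ≪ P + Q := Measure.absolutelyContinuous_of_le (Measure.le_add_right le_rfl)
  have hQ : Q ≪ P + Q := Measure.absolutelyContinuous_of_le (Measure.le_add_left le_rfl)
  rw [← Measure.setLIntegral_rnDeriv hP B, ← Measure.setLIntegral_rnDeriv hQ B,
    ← lintegral_const_mul _ (Measure.measurable_rnDeriv _ _)]
  refine setLIntegral_mono' hB fun a ha => ?_
  have h1 := h a ha
  rw [logRatio, ← log_ofReal_exp, ENNReal.log_le_log_iff] at h1
  -- Also valid where the density of `Q` vanishes: a finite quotient then forces the density of `P`
  -- to vanish too.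
  refine (ENNReal.div_le_iff_le_mul (Or.inr ENNReal.ofReal_ne_top) (Or.inr ?_)).1 h1
  simp [Real.exp_pos]

/-- Change of measure where the likelihood ratio exceeds `exp c`. -/
lemma mul_measure_le_of_lt_logRatio [IsFiniteMeasure P] [IsFiniteMeasure Q] {c : ℝ} {B : Set α}
    (hB : MeasurableSet B) (h : ∀ a ∈ B, (c : EReal) < logRatio P Q a) :
    ENNReal.ofReal (Real.exp c) * Q B ≤ P B := by
  have hP : P ≪ P + Q := Measure.absolutelyContinuous_of_le (Measure.le_add_right le_rfl)
  have hQ : Q ≪ P + Q := Measure.absolutelyContinuous_of_le (Measure.le_add_left le_rfl)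
  rw [← Measure.setLIntegral_rnDeriv hP B, ← Measure.setLIntegral_rnDeriv hQ B,
    ← lintegral_const_mul _ (Measure.measurable_rnDeriv _ _)]
  refine setLIntegral_mono' hB fun a ha => ?_
  have h1 := h a ha
  rw [logRatio, ← log_ofReal_exp, ENNReal.log_lt_log_iff] at h1
  exact ENNReal.mul_le_of_le_div h1.le

lemma measure_logRatio_le_le [IsProbabilityMeasure P] [IsProbabilityMeasure Q] (c : ℝ) :
    P {a | logRatio P Q a ≤ c} ≤ ENNReal.ofReal (Real.exp c) :=
  (measure_le_mul_of_logRatio_le (Q := Q)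
    (measurableSet_le (measurable_logRatio P Q) measurable_const) fun _ ha => ha).trans
    (mul_le_of_le_one_right zero_le prob_le_one)

/-- The change of measure gives `exp c * P B ≤ P B` with `exp c > 1`, which is possible only for a
null set `B`. -/
lemma measure_lt_logRatio_self [IsProbabilityMeasure P] {c : ℝ} (hc : 0 < c) :
    P {a | (c : EReal) < logRatio P P a} = 0 := by
  have h := mul_measure_le_of_lt_logRatio (P := P) (Q := P)
    (measurableSet_lt measurable_const (measurable_logRatio P P)) (fun a ha => ha) (c := c)
  by_contra h0
  have h1 : ENNReal.ofReal (Real.exp c) ≤ 1 := by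
    have := ENNReal.mul_le_mul_iff_left (a := ENNReal.ofReal (Real.exp c)) (b := 1) h0
      (measure_ne_top _ _)
    rw [← this, one_mul]; exact h
  rw [ENNReal.ofReal_le_one] at h1
  linarith [Real.add_one_le_exp c]

end LogRatio

/-! ### Limits in probability of normalized densities. -/

section LimitsInProbability

variable {Ω : ℕ → Type*} [∀ n, MeasurableSpace (Ω n)] {μ : ∀ n, Measure (Ω n)}
  {D : ∀ n, Ω n → EReal}

/-- Positivity matters: at `n = 0` the normalizing factor is `0⁻¹ = 0`. The limits below use it only
for large `n`. -/
lemma coe_lt_inv_mul_iff {n : ℕ} (hn : 0 < n) (a : ℝ) (x : EReal) :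
    (a : EReal) < (((n : ℝ)⁻¹ : ℝ) : EReal) * x ↔ ((n * a : ℝ) : EReal) < x := by
  have hn' : (0 : ℝ) < n := by exact_mod_cast hn
  have hi : (0 : ℝ) < (n : ℝ)⁻¹ := inv_pos.2 hn'
  induction x with
  | bot => simp [EReal.coe_mul_bot_of_pos hi]
  | top =>
    rw [EReal.coe_mul_top_of_pos hi]
    exact iff_of_true (EReal.coe_lt_top _) (EReal.coe_lt_top _)
  | coe x =>
    rw [← EReal.coe_mul, EReal.coe_lt_coe_iff, EReal.coe_lt_coe_iff, inv_mul_eq_div,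
      lt_div_iff₀ hn', mul_comm]

/-- The normalized sequence `D n / n`. -/
abbrev rate (D : ∀ n, Ω n → EReal) (n : ℕ) (ω : Ω n) : EReal := (((n : ℝ)⁻¹ : ℝ) : EReal) * D n ω

omit [∀ n, MeasurableSpace (Ω n)] in
lemma rate_neg (D : ∀ n, Ω n → EReal) : (rate fun n ω => - D n ω) = fun n ω => - rate D n ω := by
  funext n ω
  exact mul_neg _ _

lemma le_of_forall_lt_real {x y : EReal} (h : ∀ a : ℝ, (a : EReal) < x → (a : EReal) ≤ y) :
    x ≤ y := by
  by_contra! hlt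
  obtain ⟨a, h1, h2⟩ := EReal.lt_iff_exists_real_btwn.1 hlt
  exact (h a h2).not_gt h1

lemma tendsto_of_pLimsup_rate_lt {a : ℝ} (h : pLimsup μ (rate D) < a) :
    Tendsto (fun n => μ n {ω | ((n * a : ℝ) : EReal) < D n ω}) atTop (𝓝 0) := by
  simp only [pLimsup, iInf_lt_iff, exists_prop] at h
  obtain ⟨b, hb, hba⟩ := h
  refine tendsto_of_tendsto_of_tendsto_of_le_of_le' tendsto_const_nhds hb
    (Eventually.of_forall fun _ => zero_le) ?_
  filter_upwards [eventually_gt_atTop 0] with n hn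
  refine measure_mono fun ω hω => ?_
  exact hba.trans ((coe_lt_inv_mul_iff hn a _).2 hω)

lemma pLimsup_rate_le {a : ℝ}
    (h : Tendsto (fun n => μ n {ω | ((n * a : ℝ) : EReal) < D n ω}) atTop (𝓝 0)) :
    pLimsup μ (rate D) ≤ a := by
  refine iInf₂_le a (h.congr' ?_)
  filter_upwards [eventually_gt_atTop 0] with n hn
  simp only [rate, coe_lt_inv_mul_iff hn]

lemma tendsto_of_lt_pLiminf_rate {a : ℝ} (h : (a : EReal) < pLiminf μ (rate D)) :
    Tendsto (fun n => μ n {ω | D n ω < ((n * a : ℝ) : EReal)}) atTop (𝓝 0) := by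
  have h' : pLimsup μ (rate fun n ω => - D n ω) < ((-a : ℝ) : EReal) := by
    rw [EReal.coe_neg, EReal.lt_neg_comm, rate_neg]
    exact h
  refine (tendsto_of_pLimsup_rate_lt h').congr fun n => ?_
  simp only [mul_neg, EReal.coe_neg, EReal.neg_lt_neg_iff]

lemma le_pLiminf_rate {r : EReal} (h : ∀ a : ℝ, (a : EReal) < r →
    Tendsto (fun n => μ n {ω | D n ω < ((n * a : ℝ) : EReal)}) atTop (𝓝 0)) :
    r ≤ pLiminf μ (rate D) := by
  refine le_of_forall_lt_real fun a ha => ?_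
  have h' : pLimsup μ (rate fun n ω => - D n ω) ≤ ((-a : ℝ) : EReal) := by
    refine pLimsup_rate_le ((h a ha).congr fun n => ?_)
    simp only [mul_neg, EReal.coe_neg, EReal.neg_lt_neg_iff]
  rw [EReal.coe_neg, rate_neg] at h'
  exact EReal.le_neg_of_le_neg h'

lemma pLimsup_rate_le_of_forall {r : EReal} (h : ∀ a : ℝ, r < a →
    Tendsto (fun n => μ n {ω | ((n * a : ℝ) : EReal) < D n ω}) atTop (𝓝 0)) :
    pLimsup μ (rate D) ≤ r :=
  EReal.le_of_forall_lt_iff_le.1 fun a ha => pLimsup_rate_le (h a ha)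

lemma tendsto_exp_mul_neg {a : ℝ} (ha : a < 0) :
    Tendsto (fun n : ℕ => ENNReal.ofReal (Real.exp (n * a))) atTop (𝓝 0) := by
  rw [← ENNReal.ofReal_zero]
  refine ENNReal.tendsto_ofReal (Real.tendsto_exp_atBot.comp ?_)
  exact tendsto_natCast_atTop_atTop.atTop_mul_const_of_neg ha

variable {γ : ℕ → Type*} [∀ n, MeasurableSpace (γ n)] {T : ∀ n, Ω n → γ n}

/-- The spectral inf-rate of a sequence of likelihood ratios is nonnegative. -/
lemma zero_le_pLiminf_logRatio [∀ n, IsProbabilityMeasure (μ n)] (hT : ∀ n, Measurable (T n))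
    (Q : ∀ n, Measure (γ n)) [∀ n, IsProbabilityMeasure (Q n)] :
    0 ≤ pLiminf μ (rate fun n ω => logRatio ((μ n).map (T n)) (Q n) (T n ω)) := by
  refine le_pLiminf_rate fun a ha => ?_
  -- A likelihood ratio is at most `exp (n * a)` with probability at most `exp (n * a)`, which
  -- vanishes as `a < 0`.
  refine tendsto_of_tendsto_of_tendsto_of_le_of_le tendsto_const_nhds
    (tendsto_exp_mul_neg (a := a) (by exact_mod_cast ha)) (fun _ => zero_le) fun n => ?_
  have := Measure.isProbabilityMeasure_map (μ := μ n) (hT n).aemeasurable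
  refine le_trans ?_ (measure_logRatio_le_le (P := (μ n).map (T n)) (Q := Q n) (n * a))
  rw [Measure.map_apply (hT n) (measurableSet_le (measurable_logRatio _ _) measurable_const)]
  refine measure_mono fun ω hω => ?_
  simp only [Set.mem_preimage, Set.mem_ofPred_eq] at hω ⊢
  exact hω.le

/-- The spectral sup-rate of a sequence of likelihood ratios is nonnegative. -/
lemma zero_le_pLimsup_logRatio [∀ n, IsProbabilityMeasure (μ n)] (hT : ∀ n, Measurable (T n))
    (Q : ∀ n, Measure (γ n)) [∀ n, IsProbabilityMeasure (Q n)] :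
    0 ≤ pLimsup μ (rate fun n ω => logRatio ((μ n).map (T n)) (Q n) (T n ω)) := by
  by_contra! h
  obtain ⟨a, ha1, ha2⟩ := EReal.lt_iff_exists_real_btwn.1 h
  have ha : a < 0 := by exact_mod_cast ha2
  have h1 := tendsto_of_pLimsup_rate_lt ha1
  have h2 := h1.add (tendsto_exp_mul_neg ha)
  -- The upper and lower events cover the space, yet a negative sup-rate would make both
  -- probabilities vanish.
  have h3 : ∀ n, (1 : ℝ≥0∞) ≤ μ n {ω | ((n * a : ℝ) : EReal)
      < logRatio ((μ n).map (T n)) (Q n) (T n ω)} + ENNReal.ofReal (Real.exp (n * a)) := by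
    intro n
    have := Measure.isProbabilityMeasure_map (μ := μ n) (hT n).aemeasurable
    rw [← measure_univ (μ := μ n)]
    refine le_trans (le_trans (measure_mono fun ω _ => ?_) (measure_union_le _ {ω |
      logRatio ((μ n).map (T n)) (Q n) (T n ω) ≤ ((n * a : ℝ) : EReal)})) (add_le_add_right ?_ _)
    · exact lt_or_ge ((n * a : ℝ) : EReal) (logRatio ((μ n).map (T n)) (Q n) (T n ω))
    · refine le_trans ?_ (measure_logRatio_le_le (P := (μ n).map (T n)) (Q := Q n) (n * a))
      rw [Measure.map_apply (hT n) (measurableSet_le (measurable_logRatio _ _) measurable_const)]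
      exact le_rfl
  have := ge_of_tendsto' h2 h3
  simp at this

end LimitsInProbability

/-! ### From joint measures to sections. -/

section Sections

variable {α β : Type*} [MeasurableSpace α] [MeasurableSpace β] {P : Measure (α × β)}
  [IsProbabilityMeasure P] {κ : Kernel α β} [IsMarkovKernel κ] {c : ℝ≥0∞}

/-- If `P` is at most `c` times `P.fst ⊗ₘ κ` on `A`, most sections of `A` have `κ`-measure of the
order `1 / c`. -/
lemma measure_small_section_le {A : Set (α × β)} (hA : MeasurableSet A)
    (hc : ∀ B ⊆ A, MeasurableSet B → P B ≤ c * (P.fst ⊗ₘ κ) B) :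
    P.fst {a | c * κ a {b | (a, b) ∈ A} < 2⁻¹} ≤ 2 * P Aᶜ := by
  set T := {a | c * κ a {b | (a, b) ∈ A} < 2⁻¹} with hT
  have hm : Measurable fun a => κ a {b | (a, b) ∈ A} := Kernel.measurable_kernel_prodMk_left hA
  have hTm : MeasurableSet T := measurableSet_lt (hm.const_mul c) measurable_const
  -- Over `T` the sections of `A` are so small that the part of `A` above `T` has at most half the
  -- mass of `T`; the rest of that mass lies outside `A`.
  have h1 : P.fst T ≤ 2⁻¹ * P.fst T + P Aᶜ := by
    calc P.fst T = P (Prod.fst ⁻¹' T) := Measure.fst_apply hTm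
      _ ≤ P (A ∩ Prod.fst ⁻¹' T) + P Aᶜ := by
          refine (measure_mono ?_).trans (measure_union_le _ _)
          intro x hx
          by_cases h : x ∈ A
          · exact Or.inl ⟨h, hx⟩
          · exact Or.inr h
      _ ≤ 2⁻¹ * P.fst T + P Aᶜ := by
          refine add_le_add_left ?_ _
          have hm' := hA.inter (measurable_fst hTm)
          refine (hc _ Set.inter_subset_left hm').trans ?_
          rw [Measure.compProd_apply hm',
            ← lintegral_const_mul _ (Kernel.measurable_kernel_prodMk_left hm')]
          calc _ ≤ ∫⁻ a, T.indicator (fun _ => 2⁻¹) a ∂P.fst := by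
                  refine lintegral_mono fun a => ?_
                  by_cases ha : a ∈ T
                  · rw [Set.indicator_of_mem ha]
                    refine le_trans ?_ (le_of_lt ha)
                    exact mul_le_mul_right (measure_mono fun b hb => hb.1) _
                  · have : (Prod.mk a ⁻¹' (A ∩ Prod.fst ⁻¹' T)) = ∅ := by
                      ext b; simp [ha]
                    simp [this]
              _ = _ := by rw [lintegral_indicator_const hTm]
  rw [← ENNReal.inv_mul_le_iff two_ne_zero ENNReal.ofNat_ne_top]
  have h2 : 2⁻¹ * P.fst T + 2⁻¹ * P.fst T ≤ 2⁻¹ * P.fst T + P Aᶜ := by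
    rwa [← add_mul, ENNReal.inv_two_add_inv_two, one_mul]
  exact (ENNReal.add_le_add_iff_left (ENNReal.mul_ne_top (by simp) (measure_ne_top _ _))).1 h2

/-- If `P` is at least `c` times `P.fst ⊗ₘ κ` on `D`, almost all sections of `D` have `κ`-measure
at most `1 / c`. -/
lemma ae_mul_section_le_one {D : Set (α × β)} (hD : MeasurableSet D)
    (hc : ∀ B ⊆ D, MeasurableSet B → c * (P.fst ⊗ₘ κ) B ≤ P B) :
    ∀ᵐ a ∂P.fst, c * κ a {b | (a, b) ∈ D} ≤ 1 := by
  have hm : Measurable fun a => κ a {b | (a, b) ∈ D} := Kernel.measurable_kernel_prodMk_left hD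
  refine ae_le_of_forall_setLIntegral_le_of_sigmaFinite (hm.const_mul c) fun T hT _ => ?_
  have hm' := hD.inter (measurable_fst hT)
  have h1 := hc _ Set.inter_subset_left hm'
  calc ∫⁻ a in T, c * κ a {b | (a, b) ∈ D} ∂P.fst = c * (P.fst ⊗ₘ κ) (D ∩ Prod.fst ⁻¹' T) := by
        rw [Measure.compProd_apply hm', lintegral_const_mul _ hm, ← lintegral_indicator hT]
        congr 1
        refine lintegral_congr fun a => ?_
        by_cases ha : a ∈ T
        · rw [Set.indicator_of_mem ha]
          congr 1
          ext b; simp [ha]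
        · have : (Prod.mk a ⁻¹' (D ∩ Prod.fst ⁻¹' T)) = ∅ := by
            ext b; simp [ha]
          simp [this, ha]
    _ ≤ P (Prod.fst ⁻¹' T) := h1.trans (measure_mono Set.inter_subset_right)
    _ = P.fst T := (Measure.fst_apply hT).symm
    _ = ∫⁻ _ in T, 1 ∂P.fst := by simp

end Sections

/-! ### Section bounds from log-likelihood ratios. -/

section LogRatioSections

variable {α β γ : Type*} [MeasurableSpace α] [MeasurableSpace β] [MeasurableSpace γ]
  {P Q : Measure γ} [IsProbabilityMeasure P] [IsFiniteMeasure Q] {κ : Kernel α β}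
  [IsMarkovKernel κ] {e : γ → α × β}

/-- The map `e` puts the coordinate to be drawn at random last, so that one statement serves the
plain and the conditional densities. -/
lemma measure_small_section_le_of_logRatio_le (he : Measurable e)
    (hQ : Q.map e = (P.map e).fst ⊗ₘ κ) {c : ℝ} {A : Set (α × β)} (hA : MeasurableSet A)
    (h : ∀ x, e x ∈ A → logRatio P Q x ≤ c) :
    (P.map e).fst {a | ENNReal.ofReal (Real.exp c) * κ a {b | (a, b) ∈ A} < 2⁻¹}
      ≤ 2 * (P.map e) Aᶜ := by
  have := Measure.isProbabilityMeasure_map (μ := P) he.aemeasurable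
  refine measure_small_section_le hA fun B hBA hB => ?_
  rw [← hQ, Measure.map_apply he hB, Measure.map_apply he hB]
  exact measure_le_mul_of_logRatio_le (he hB) fun x hx => h x (hBA hx)

lemma ae_mul_section_le_one_of_lt_logRatio (he : Measurable e)
    (hQ : Q.map e = (P.map e).fst ⊗ₘ κ) {c : ℝ} {D : Set (α × β)} (hD : MeasurableSet D)
    (h : ∀ x, e x ∈ D → (c : EReal) < logRatio P Q x) :
    ∀ᵐ a ∂(P.map e).fst, ENNReal.ofReal (Real.exp c) * κ a {b | (a, b) ∈ D} ≤ 1 := by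
  have := Measure.isProbabilityMeasure_map (μ := P) he.aemeasurable
  refine ae_mul_section_le_one hD fun B hBD hB => ?_
  rw [← hQ, Measure.map_apply he hB, Measure.map_apply he hB]
  exact mul_measure_le_of_lt_logRatio (he hB) fun x hx => h x (hBD hx)

/-- If a set has probability at least `exp (-c) / 2`, then `L` independent draws miss it with
probability at most `exp (-L exp (-c) / 2)`. -/
lemma measure_compl_pow_le {π : Measure α} [IsProbabilityMeasure π] {A : Set α}
    (hA : MeasurableSet A) {c : ℝ} (h : 2⁻¹ ≤ ENNReal.ofReal (Real.exp c) * π A) (L : ℕ) :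
    π Aᶜ ^ L ≤ ENNReal.ofReal (Real.exp (-(L * Real.exp (-c) / 2))) := by
  have h1 : π Aᶜ = ENNReal.ofReal (1 - π.real A) := by
    rw [← probReal_compl_eq_one_sub hA, ofReal_measureReal]
  have h2 : Real.exp (-c) / 2 ≤ π.real A := by
    rw [← ofReal_measureReal (μ := π) (s := A), ← ENNReal.ofReal_mul (Real.exp_pos c).le,
      show (2⁻¹ : ℝ≥0∞) = ENNReal.ofReal 2⁻¹ by
        rw [ENNReal.ofReal_inv_of_pos two_pos]; simp,
      ENNReal.ofReal_le_ofReal_iff (by positivity)] at h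
    rw [Real.exp_neg, div_le_iff₀ two_pos, inv_le_iff_one_le_mul₀ (Real.exp_pos c)]
    linarith
  have h3 : 0 ≤ 1 - π.real A := sub_nonneg.2 measureReal_le_one
  rw [h1, ← ENNReal.ofReal_pow h3]
  refine ENNReal.ofReal_le_ofReal ?_
  calc (1 - π.real A) ^ L ≤ (Real.exp (-(Real.exp (-c) / 2))) ^ L := by
        refine pow_le_pow_left₀ h3 ?_ L
        linarith [Real.add_one_le_exp (-(Real.exp (-c) / 2))]
    _ = _ := by
        rw [← Real.exp_nat_mul]
        congr 1
        ring

end LogRatioSections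

/-! ### Symmetry of the conditionally independent coupling. -/

section CondDistrib

variable {Ω α β γ : Type*} [MeasurableSpace Ω] [MeasurableSpace α] [StandardBorelSpace α]
  [Nonempty α] [MeasurableSpace β] [StandardBorelSpace β] [Nonempty β] [MeasurableSpace γ]
  {μ : Measure Ω} [IsProbabilityMeasure μ] {A : Ω → α} {B : Ω → β} {C : Ω → γ}

lemma lintegral_map_prodMk (hA : Measurable A) (hC : Measurable C) {f : α × γ → ℝ≥0∞}
    (hf : Measurable f) :
    ∫⁻ q, f q ∂(μ.map fun ω => (A ω, C ω))
      = ∫⁻ c, ∫⁻ a, f (a, c) ∂(condDistrib A C μ c) ∂(μ.map C) := by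
  have := Measure.isProbabilityMeasure_map (μ := μ) hC.aemeasurable
  have hf' : Measurable fun q : γ × α => f q.swap := hf.comp measurable_swap
  calc _ = ∫⁻ q, f q.swap ∂(μ.map fun ω => (C ω, A ω)) := by
        rw [lintegral_map hf (hA.prodMk hC), lintegral_map hf' (hC.prodMk hA)]
        rfl
    _ = _ := by
        rw [← compProd_map_condDistrib hA.aemeasurable,
          Measure.lintegral_compProd hf']
        rfl

/-- The conditionally independent coupling of `A` and `B` given `C` is symmetric. -/
lemma map_compProd_condDistrib_swap (hA : Measurable A) (hB : Measurable B) (hC : Measurable C) :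
    ((μ.map fun ω => (A ω, C ω)) ⊗ₘ (Kernel.prodMkLeft α (condDistrib B C μ))).map
        (fun q => ((q.2, q.1.2), q.1.1))
      = (μ.map fun ω => (B ω, C ω)) ⊗ₘ (Kernel.prodMkLeft β (condDistrib A C μ)) := by
  have := Measure.isProbabilityMeasure_map (μ := μ) (hA.prodMk hC).aemeasurable
  have := Measure.isProbabilityMeasure_map (μ := μ) (hB.prodMk hC).aemeasurable
  have he : Measurable fun q : (α × γ) × β => ((q.2, q.1.2), q.1.1) := by fun_prop
  ext E hE
  rw [Measure.map_apply he hE, Measure.compProd_apply (he hE), Measure.compProd_apply hE,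
    lintegral_map_prodMk hA hC (Kernel.measurable_kernel_prodMk_left (he hE)),
    lintegral_map_prodMk hB hC (Kernel.measurable_kernel_prodMk_left hE)]
  refine lintegral_congr fun c => ?_
  have hE' : MeasurableSet {q : α × β | ((q.2, c), q.1) ∈ E} := hE.preimage (by fun_prop)
  have h1 := Measure.prod_apply (μ := condDistrib A C μ c) (ν := condDistrib B C μ c) hE'
  rw [Measure.prod_apply_symm hE'] at h1
  exact h1.symm

end CondDistrib

/-! ### Covering and packing for information densities. -/

section Densities

variable {Ω α β γ : Type*} [MeasurableSpace Ω] [MeasurableSpace α] [MeasurableSpace β]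
  [MeasurableSpace γ] {μ : Measure Ω} [IsProbabilityMeasure μ] {A : Ω → α} {B : Ω → β} {C : Ω → γ}

lemma map_swap_prod_map (hA : Measurable A) (hB : Measurable B) :
    ((μ.map A).prod (μ.map B)).map Prod.swap
      = ((μ.map fun ω => (A ω, B ω)).map Prod.swap).fst ⊗ₘ Kernel.const β (μ.map A) := by
  have := Measure.isProbabilityMeasure_map (μ := μ) hA.aemeasurable
  have := Measure.isProbabilityMeasure_map (μ := μ) hB.aemeasurable
  rw [Measure.map_map measurable_swap (hA.prodMk hB), Measure.fst,
    Measure.map_map measurable_fst (measurable_swap.comp (hA.prodMk hB)), Measure.compProd_const,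
    Measure.prod_swap]
  rfl

/-- Covering: for most values of `B` there are sufficiently many fitting values of `A`. -/
lemma covering_infoDensity (hA : Measurable A) (hB : Measurable B) {c : ℝ} {E : Set (β × α)}
    (hE : MeasurableSet E) (h : ∀ q ∈ E, logRatio (μ.map fun ω => (A ω, B ω))
      ((μ.map A).prod (μ.map B)) (q.2, q.1) ≤ c) :
    (μ.map B) {b | ENNReal.ofReal (Real.exp c) * (μ.map A) {a | (b, a) ∈ E} < 2⁻¹}
      ≤ 2 * μ {ω | (B ω, A ω) ∉ E} := by
  have := Measure.isProbabilityMeasure_map (μ := μ) hA.aemeasurable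
  have := Measure.isProbabilityMeasure_map (μ := μ) hB.aemeasurable
  have := Measure.isProbabilityMeasure_map (μ := μ) (hA.prodMk hB).aemeasurable
  have h1 := measure_small_section_le_of_logRatio_le measurable_swap
    (map_swap_prod_map (μ := μ) hA hB) hE fun x hx => h _ hx
  rw [Measure.map_map measurable_swap (hA.prodMk hB),
    Measure.map_apply (measurable_swap.comp (hA.prodMk hB)) hE.compl, Measure.fst,
    Measure.map_map measurable_fst (measurable_swap.comp (hA.prodMk hB))] at h1
  exact h1

/-- Packing: for almost all values of `B` an independent copy of `A` rarely matches. -/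
lemma packing_infoDensity (hA : Measurable A) (hB : Measurable B) {c : ℝ} {E : Set (β × α)}
    (hE : MeasurableSet E) (h : ∀ q ∈ E, (c : EReal) < logRatio (μ.map fun ω => (A ω, B ω))
      ((μ.map A).prod (μ.map B)) (q.2, q.1)) :
    ∀ᵐ ω ∂μ, ENNReal.ofReal (Real.exp c) * (μ.map A) {a | (B ω, a) ∈ E} ≤ 1 := by
  have := Measure.isProbabilityMeasure_map (μ := μ) hA.aemeasurable
  have := Measure.isProbabilityMeasure_map (μ := μ) hB.aemeasurable
  have := Measure.isProbabilityMeasure_map (μ := μ) (hA.prodMk hB).aemeasurable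
  have h1 := ae_mul_section_le_one_of_lt_logRatio measurable_swap
    (map_swap_prod_map (μ := μ) hA hB) hE fun x hx => h _ hx
  rw [Measure.map_map measurable_swap (hA.prodMk hB), Measure.fst,
    Measure.map_map measurable_fst (measurable_swap.comp (hA.prodMk hB))] at h1
  exact ae_of_ae_map hB.aemeasurable h1

variable [StandardBorelSpace α] [Nonempty α] [StandardBorelSpace β] [Nonempty β]

/-- The conditional density is defined through the law of `B` given `C`, whereas codewords are drawn
from the law of `A` given `C`. Symmetry of the coupling passes from one to the other. -/
lemma map_compProd_condDistrib_eq (hA : Measurable A) (hB : Measurable B) (hC : Measurable C) :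
    ((μ.map fun ω => (A ω, C ω)) ⊗ₘ (Kernel.prodMkLeft α (condDistrib B C μ))).map
        (fun q => ((q.2, q.1.2), q.1.1))
      = ((μ.map fun ω => ((A ω, C ω), B ω)).map (fun q => ((q.2, q.1.2), q.1.1))).fst
        ⊗ₘ (Kernel.prodMkLeft β (condDistrib A C μ)) := by
  rw [map_compProd_condDistrib_swap hA hB hC, Measure.map_map (by fun_prop) (by fun_prop),
    Measure.fst, Measure.map_map (by fun_prop) (by fun_prop)]
  rfl

lemma covering_condInfoDensity (hA : Measurable A) (hB : Measurable B) (hC : Measurable C) {c : ℝ}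
    {E : Set ((β × γ) × α)} (hE : MeasurableSet E)
    (h : ∀ q ∈ E, logRatio (μ.map fun ω => ((A ω, C ω), B ω))
      ((μ.map fun ω => (A ω, C ω)) ⊗ₘ (Kernel.prodMkLeft α (condDistrib B C μ)))
      ((q.2, q.1.2), q.1.1) ≤ c) :
    μ {ω | ENNReal.ofReal (Real.exp c) * condDistrib A C μ (C ω) {a | ((B ω, C ω), a) ∈ E} < 2⁻¹}
      ≤ 2 * μ {ω | ((B ω, C ω), A ω) ∉ E} := by
  have := Measure.isProbabilityMeasure_map (μ := μ) (hA.prodMk hC).aemeasurable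
  have := Measure.isProbabilityMeasure_map (μ := μ) ((hA.prodMk hC).prodMk hB).aemeasurable
  have he : Measurable fun q : (α × γ) × β => ((q.2, q.1.2), q.1.1) := by fun_prop
  have h1 := measure_small_section_le_of_logRatio_le he
    (map_compProd_condDistrib_eq (μ := μ) hA hB hC) hE fun x hx => h _ hx
  have hm : Measurable fun q : β × γ =>
      (Kernel.prodMkLeft β (condDistrib A C μ)) q {a | (q, a) ∈ E} :=
    Kernel.measurable_kernel_prodMk_left hE
  rw [Measure.map_map he (by fun_prop), Measure.map_apply (by fun_prop) hE.compl, Measure.fst,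
    Measure.map_map (by fun_prop) (by fun_prop), Measure.map_apply (by fun_prop)
    (measurableSet_lt (hm.const_mul _) measurable_const)] at h1
  exact h1

/-- The bound is only almost sure; exceptional values of `(B, C)` have to be removed from the
decoding sets. -/
lemma packing_condInfoDensity (hA : Measurable A) (hB : Measurable B) (hC : Measurable C) {c : ℝ}
    {E : Set ((β × γ) × α)} (hE : MeasurableSet E)
    (h : ∀ q ∈ E, (c : EReal) < logRatio (μ.map fun ω => ((A ω, C ω), B ω))
      ((μ.map fun ω => (A ω, C ω)) ⊗ₘ (Kernel.prodMkLeft α (condDistrib B C μ)))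
      ((q.2, q.1.2), q.1.1)) :
    ∀ᵐ ω ∂μ, ENNReal.ofReal (Real.exp c) *
      condDistrib A C μ (C ω) {a | ((B ω, C ω), a) ∈ E} ≤ 1 := by
  have := Measure.isProbabilityMeasure_map (μ := μ) (hA.prodMk hC).aemeasurable
  have := Measure.isProbabilityMeasure_map (μ := μ) ((hA.prodMk hC).prodMk hB).aemeasurable
  have he : Measurable fun q : (α × γ) × β => ((q.2, q.1.2), q.1.1) := by fun_prop
  have h1 := ae_mul_section_le_one_of_lt_logRatio he
    (map_compProd_condDistrib_eq (μ := μ) hA hB hC) hE fun x hx => h _ hx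
  rw [Measure.map_map he (by fun_prop), Measure.fst,
    Measure.map_map (by fun_prop) (by fun_prop)] at h1
  exact ae_of_ae_map (f := fun ω => (B ω, C ω)) (by fun_prop) h1

end Densities

/-! ### One-shot achievability. -/

section OneShot

lemma le_ofReal_exp_neg {c : ℝ} {x : ℝ≥0∞} (h : ENNReal.ofReal (Real.exp c) * x ≤ 1) :
    x ≤ ENNReal.ofReal (Real.exp (-c)) := by
  rw [Real.exp_neg, ENNReal.ofReal_inv_of_pos (Real.exp_pos c)]
  exact ENNReal.le_inv_iff_mul_le.2 (by rwa [mul_comm])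

variable {U V X S Y : Type*} [MeasurableSpace U] [StandardBorelSpace U] [MeasurableSpace V]
  [MeasurableSpace X] [StandardBorelSpace X] [MeasurableSpace S] [StandardBorelSpace S] [Nonempty S]
  [MeasurableSpace Y] [StandardBorelSpace Y] [Nonempty Y]

/-- The channel from `((S, V), U)` to `Y` obtained by averaging `W` over the input. -/
def inputAveraged (κ : Kernel ((S × V) × U) X) (W : Kernel (X × S) Y) :
    Kernel ((S × V) × U) Y :=
  (κ ⊗ₖ W.comap (fun q : ((S × V) × U) × X => (q.2, q.1.1.1)) (by fun_prop)).snd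

instance (κ : Kernel ((S × V) × U) X) [IsMarkovKernel κ] (W : Kernel (X × S) Y)
    [IsMarkovKernel W] : IsMarkovKernel (inputAveraged κ W) := by
  unfold inputAveraged; infer_instance

omit [StandardBorelSpace U] [StandardBorelSpace X] [StandardBorelSpace S] [Nonempty S]
  [StandardBorelSpace Y] [Nonempty Y] in
lemma inputAveraged_apply (κ : Kernel ((S × V) × U) X) [IsMarkovKernel κ] (W : Kernel (X × S) Y)
    [IsMarkovKernel W] (z : (S × V) × U) {E : Set Y} (hE : MeasurableSet E) :
    inputAveraged κ W z E = ∫⁻ x, W (x, z.1.1) E ∂(κ z) := by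
  rw [inputAveraged, Kernel.snd_apply' _ _ hE, Kernel.compProd_apply (measurable_snd hE)]
  rfl

-- By the Markov chain, drawing `X` from its law given `(S, V, U)` and then the output from `W`
-- reproduces the joint law of `(S, V, U, Y)`. Error probabilities of the averaged channel can thus
-- be read off from `μ`.
omit [StandardBorelSpace U] [StandardBorelSpace S] [Nonempty S]
  [StandardBorelSpace Y] [Nonempty Y] in
lemma lintegral_inputAveraged [Nonempty X] (W : Kernel (X × S) Y) [IsMarkovKernel W]
    {μ : Measure (((U × V) × (X × S)) × Y)} [IsProbabilityMeasure μ]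
    (hμ : μ = μ.fst ⊗ₘ Kernel.prodMkLeft (U × V) W) {E : Set (((S × V) × U) × Y)}
    (hE : MeasurableSet E) :
    ∫⁻ z, inputAveraged (condDistrib (fun ω => ω.1.2.1)
        (fun ω => ((ω.1.2.2, ω.1.1.2), ω.1.1.1)) μ) W z {y | (z, y) ∈ E}
        ∂(μ.map fun ω => ((ω.1.2.2, ω.1.1.2), ω.1.1.1))
      = μ {ω | (((ω.1.2.2, ω.1.1.2), ω.1.1.1), ω.2) ∈ E} := by
  have hZ : Measurable fun ω : ((U × V) × (X × S)) × Y => ((ω.1.2.2, ω.1.1.2), ω.1.1.1) := by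
    fun_prop
  have hX : Measurable fun ω : ((U × V) × (X × S)) × Y => ω.1.2.1 := by fun_prop
  have hsec (z : (S × V) × U) : MeasurableSet {y | (z, y) ∈ E} := measurable_prodMk_left hE
  have hf : Measurable fun q : X × ((S × V) × U) => W (q.1, q.2.1.1) {y | (q.2, y) ∈ E} := by
    refine measurable_kernel_section W (z := fun q : X × ((S × V) × U) => (q.1, q.2.1.1))
      (by fun_prop) (p := fun q y => (q.2, y) ∈ E) ?_
    exact hE.preimage (by fun_prop)
  simp only [inputAveraged_apply _ _ _ (hsec _)]
  rw [← lintegral_map_prodMk hX hZ hf, lintegral_map hf (hX.prodMk hZ)]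
  have hE' : MeasurableSet
      {ω : ((U × V) × (X × S)) × Y | (((ω.1.2.2, ω.1.1.2), ω.1.1.1), ω.2) ∈ E} :=
    hE.preimage (by fun_prop)
  conv_rhs => rw [hμ, Measure.compProd_apply hE', Measure.fst]
  rw [lintegral_map (Kernel.measurable_kernel_prodMk_left hE') measurable_fst]
  rfl

/-- **One-shot achievability.** -/
theorem exists_code_of_joint (W : Kernel (X × S) Y) [IsMarkovKernel W]
    {μ : Measure (((U × V) × (X × S)) × Y)} [IsProbabilityMeasure μ]
    (hμ : μ = μ.fst ⊗ₘ Kernel.prodMkLeft (U × V) W) (c₁ c₂ b₁ b₂ : ℝ) {δ : ℝ≥0∞} (hδ : δ ≠ 0)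
    (hδ' : δ ≠ ⊤) (L K M B : ℕ) [NeZero L] [NeZero K] [NeZero M] [NeZero B] :
    ∃ (f : S → Fin B) (e : Kernel (Fin M × S) X) (φ : Y × Fin B → Fin M),
      Measurable f ∧ IsMarkovKernel e ∧ Measurable φ ∧
      (M : ℝ≥0∞)⁻¹ * ∑ m : Fin M, ∫⁻ s, ∫⁻ x, W (x, s) {y | φ (y, f s) ≠ m} ∂(e (m, s))
          ∂(μ.map fun ω => ω.1.2.2)
        ≤ 2 * (μ {ω | (c₁ : EReal) < infoDensity μ (fun ω => ω.1.1.2) (fun ω => ω.1.2.2) ω}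
            + 2 * (μ {ω | (c₂ : EReal) < condInfoDensity μ (fun ω => ω.1.1.1) (fun ω => ω.1.2.2)
                (fun ω => ω.1.1.2) ω}
              + (μ {ω | infoDensity μ (fun ω => ω.1.1.2) (fun ω => ω.2) ω ≤ b₁}
                + μ {ω | condInfoDensity μ (fun ω => ω.1.1.1) (fun ω => ω.2)
                    (fun ω => ω.1.1.2) ω ≤ b₂}) / δ))
          + ENNReal.ofReal (Real.exp (-(L * Real.exp (-c₁) / 2)))
          + ENNReal.ofReal (Real.exp (-(K * Real.exp (-c₂) / 2)))
          + δ
          + L * (ENNReal.ofReal (Real.exp (-b₁)) * (B : ℝ≥0∞)⁻¹)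
          + ((M - 1 : ℕ) * K : ℝ≥0∞) * ENNReal.ofReal (Real.exp (-b₂)) := by
  obtain ⟨ω₀⟩ := nonempty_of_isProbabilityMeasure μ
  have : Nonempty U := ⟨ω₀.1.1.1⟩
  have : Nonempty X := ⟨ω₀.1.2.1⟩
  set fU : ((U × V) × (X × S)) × Y → U := fun ω => ω.1.1.1 with hfU
  set fV : ((U × V) × (X × S)) × Y → V := fun ω => ω.1.1.2 with hfV
  set fS : ((U × V) × (X × S)) × Y → S := fun ω => ω.1.2.2 with hfS
  set fY : ((U × V) × (X × S)) × Y → Y := fun ω => ω.2 with hfY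
  have hU : Measurable fU := by fun_prop
  have hV : Measurable fV := by fun_prop
  have hS : Measurable fS := by fun_prop
  have hY : Measurable fY := by fun_prop
  have := Measure.isProbabilityMeasure_map (μ := μ) hV.aemeasurable
  have := Measure.isProbabilityMeasure_map (μ := μ) hS.aemeasurable
  set κU := condDistrib fU fV μ
  set iVS := logRatio (μ.map fun ω => (fV ω, fS ω)) ((μ.map fV).prod (μ.map fS)) with hiVS
  set iVY := logRatio (μ.map fun ω => (fV ω, fY ω)) ((μ.map fV).prod (μ.map fY)) with hiVY
  set iUS := logRatio (μ.map fun ω => ((fU ω, fV ω), fS ω))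
    ((μ.map fun ω => (fU ω, fV ω)) ⊗ₘ (Kernel.prodMkLeft U (condDistrib fS fV μ))) with hiUS
  set iUY := logRatio (μ.map fun ω => ((fU ω, fV ω), fY ω))
    ((μ.map fun ω => (fU ω, fV ω)) ⊗ₘ (Kernel.prodMkLeft U (condDistrib fY fV μ))) with hiUY
  have miVS : Measurable iVS := measurable_logRatio _ _
  have miVY : Measurable iVY := measurable_logRatio _ _
  have miUS : Measurable iUS := measurable_logRatio _ _
  have miUY : Measurable iUY := measurable_logRatio _ _
  -- the decoding sets
  set F₁ : Set (Y × V) := {q | (b₁ : EReal) < iVY (q.2, q.1)} with hF₁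
  have mF₁ : MeasurableSet F₁ := measurableSet_lt measurable_const (miVY.comp (by fun_prop))
  -- Restricting the decoding sets to outputs that satisfy the packing bound makes `hd₁` hold for
  -- every output and costs nothing, as the others form a null set. `G₂` serves `hd₂` likewise.
  set G₁ : Set Y := {y | ENNReal.ofReal (Real.exp b₁) * (μ.map fV) {v | (y, v) ∈ F₁} ≤ 1} with hG₁
  have mG₁ : MeasurableSet G₁ := measurableSet_le
    ((measurable_measure_prodMk_left mF₁).const_mul _) measurable_const
  set F₂ : Set ((Y × V) × U) := {q | (b₂ : EReal) < iUY ((q.2, q.1.2), q.1.1)} with hF₂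
  have mF₂ : MeasurableSet F₂ := measurableSet_lt measurable_const (miUY.comp (by fun_prop))
  set G₂ : Set (Y × V) := {q | ENNReal.ofReal (Real.exp b₂) * κU q.2 {u | (q, u) ∈ F₂} ≤ 1} with hG₂
  have mG₂ : MeasurableSet G₂ := measurableSet_le
    ((measurable_kernel_section κU measurable_snd mF₂).const_mul _) measurable_const
  set D₁ : Set (V × Y) := {q | (q.2, q.1) ∈ F₁ ∧ q.2 ∈ G₁} with hD₁
  have mD₁ : MeasurableSet D₁ := (mF₁.preimage (by fun_prop)).inter (mG₁.preimage (by fun_prop))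
  set D₂ : Set ((V × U) × Y) := {q | ((q.2, q.1.1), q.1.2) ∈ F₂ ∧ (q.2, q.1.1) ∈ G₂} with hD₂
  have mD₂ : MeasurableSet D₂ := (mF₂.preimage (by fun_prop)).inter (mG₂.preimage (by fun_prop))
  set E : Set (((S × V) × U) × Y) :=
    {q | (q.1.1.2, q.2) ∉ D₁ ∨ ((q.1.1.2, q.1.2), q.2) ∉ D₂} with hE
  have mE : MeasurableSet E :=
    (mD₁.preimage (by fun_prop)).compl.union (mD₂.preimage (by fun_prop)).compl
  have hbad : μ {ω | (((fS ω, fV ω), fU ω), fY ω) ∈ E}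
      ≤ μ {ω | infoDensity μ fV fY ω ≤ b₁} + μ {ω | condInfoDensity μ fU fY fV ω ≤ b₂} := by
    have ae₁ := packing_infoDensity (μ := μ) hV hY mF₁ fun q hq => hq
    have ae₂ := packing_condInfoDensity (μ := μ) hU hY hV mF₂ fun q hq => hq
    refine le_trans (measure_mono_ae ?_) (measure_union_le _ _)
    filter_upwards [ae₁, ae₂] with ω h1 h2 h3
    rcases h3 with h3 | h3
    · refine Or.inl ?_
      by_contra hcon
      have h4 : (b₁ : EReal) < infoDensity μ fV fY ω := not_le.1 hcon
      exact h3 ⟨h4, h1⟩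
    · refine Or.inr ?_
      by_contra hcon
      have h4 : (b₂ : EReal) < condInfoDensity μ fU fY fV ω := not_le.1 hcon
      exact h3 ⟨h4, h2⟩
  -- the fitting sets
  set κX := condDistrib (fun ω : ((U × V) × (X × S)) × Y => ω.1.2.1)
    (fun ω => ((fS ω, fV ω), fU ω)) μ
  set N := inputAveraged κX W with hN
  have mN : Measurable fun z => N z {y | (z, y) ∈ E} := Kernel.measurable_kernel_prodMk_left mE
  -- The second condition demands that the resulting output fail a decoding test with probability at
  -- most `δ`. This gives the pointwise hypothesis of `exists_code_of_sets`, and Markov's inequality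
  -- bounds the loss by the probability of failure divided by `δ`.
  set A₂ : Set ((S × V) × U) := {z | iUS ((z.2, z.1.2), z.1.1) ≤ c₂ ∧ N z {y | (z, y) ∈ E} ≤ δ}
    with hA₂
  have mA₂ : MeasurableSet A₂ := (measurableSet_le (miUS.comp (by fun_prop)) measurable_const).inter
    (measurableSet_le mN measurable_const)
  -- The second condition ensures that a satellite codeword drawn around a fitting codeword fits
  -- with probability at least `exp (-c₂) / 2`.
  set A₁ : Set (S × V) := {q | iVS (q.2, q.1) ≤ c₁ ∧
    2⁻¹ ≤ ENNReal.ofReal (Real.exp c₂) * κU q.2 {u | (q, u) ∈ A₂}} with hA₁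
  have mA₁ : MeasurableSet A₁ := (measurableSet_le (miVS.comp (by fun_prop)) measurable_const).inter
    (measurableSet_le measurable_const
      ((measurable_kernel_section κU measurable_snd mA₂).const_mul _))
  have hPA₂ : μ {ω | ((fS ω, fV ω), fU ω) ∉ A₂}
      ≤ μ {ω | (c₂ : EReal) < condInfoDensity μ fU fS fV ω}
      + (μ {ω | infoDensity μ fV fY ω ≤ b₁} + μ {ω | condInfoDensity μ fU fY fV ω ≤ b₂}) / δ := by
    have h1 : μ {ω | δ < N ((fS ω, fV ω), fU ω) {y | (((fS ω, fV ω), fU ω), y) ∈ E}}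
        ≤ (μ {ω | infoDensity μ fV fY ω ≤ b₁} + μ {ω | condInfoDensity μ fU fY fV ω ≤ b₂}) / δ := by
      have h2 := meas_ge_le_lintegral_div (μ := μ.map fun ω => ((fS ω, fV ω), fU ω))
        mN.aemeasurable hδ hδ'
      rw [lintegral_inputAveraged W hμ mE, Measure.map_apply (by fun_prop)
        (measurableSet_le measurable_const mN)] at h2
      refine le_trans (measure_mono fun ω hω => ?_) (h2.trans (ENNReal.div_le_div_right hbad δ))
      have h3 : δ < N ((fS ω, fV ω), fU ω) {y | (((fS ω, fV ω), fU ω), y) ∈ E} := hω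
      exact h3.le
    refine le_trans (measure_mono fun ω hω => ?_) ((measure_union_le _ _).trans
      (add_le_add_right h1 _))
    by_contra hcon
    exact hω ⟨not_lt.1 fun h => hcon (Or.inl h), not_lt.1 fun h => hcon (Or.inr h)⟩
  have hPA₁ : μ {ω | (fS ω, fV ω) ∉ A₁} ≤ μ {ω | (c₁ : EReal) < infoDensity μ fV fS ω}
      + 2 * μ {ω | ((fS ω, fV ω), fU ω) ∉ A₂} := by
    have h1 := covering_condInfoDensity (μ := μ) hU hS hV mA₂ fun q hq => hq.1
    refine le_trans (measure_mono fun ω hω => ?_) ((measure_union_le _ _).trans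
      (add_le_add_right h1 _))
    by_contra hcon
    exact hω ⟨not_lt.1 fun h => hcon (Or.inl h), not_lt.1 fun h => hcon (Or.inr h)⟩
  have hcov := covering_infoDensity (μ := μ) hV hS mA₁ fun q hq => hq.1
  -- The conditional law of `U` given `v` is the image of the uniform law under `g v`. One array of
  -- uniform variables, independent of the first layer, therefore supplies the satellites of every
  -- codeword.
  obtain ⟨g, hg, hgκ⟩ := κU.exists_measurable_map_eq_unitInterval
  have hgv (v : V) : Measurable (g v) := hg.comp measurable_prodMk_left
  have hvol (v : V) {T : Set U} (hT : MeasurableSet T) : volume {x | g v x ∈ T} = κU v T := by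
    rw [← hgκ v, Measure.map_apply (hgv v) hT]
    rfl
  -- codewords carry the index of their bin; satellite codewords are given by uniform variables
  set pB : Measure (Fin B) := (PMF.uniformOfFintype (Fin B)).toMeasure
  set r : (S × (V × Fin B)) × unitInterval → (S × V) × U :=
    fun z => ((z.1.1, z.1.2.1), g z.1.2.1 z.2) with hr
  have mg : Measurable fun z : (S × (V × Fin B)) × unitInterval => g z.1.2.1 z.2 :=
    hg.comp (f := fun z : (S × (V × Fin B)) × unitInterval => (z.1.2.1, z.2)) (by fun_prop)
  have mr : Measurable r := by fun_prop
  have mg' : Measurable fun z : ((V × Fin B) × unitInterval) × Y => g z.1.1.1 z.1.2 :=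
    hg.comp (f := fun z : ((V × Fin B) × unitInterval) × Y => (z.1.1.1, z.1.2)) (by fun_prop)
  have hfit₁ : (μ.map fS) {s | ENNReal.ofReal (Real.exp (-(L * Real.exp (-c₁) / 2)))
      < ((μ.map fV).prod pB) {w | (s, w) ∉ {q : S × (V × Fin B) | (q.1, q.2.1) ∈ A₁}} ^ L}
      ≤ 2 * μ {ω | (fS ω, fV ω) ∉ A₁} := by
    refine le_trans (measure_mono fun s hs => ?_) hcov
    have hs' : ENNReal.ofReal (Real.exp (-(L * Real.exp (-c₁) / 2)))
      < ((μ.map fV).prod pB) {w | (s, w.1) ∉ A₁} ^ L := hs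
    by_contra hcon
    have hcon' : 2⁻¹ ≤ ENNReal.ofReal (Real.exp c₁) * (μ.map fV) {v | (s, v) ∈ A₁} := not_lt.1 hcon
    have h1 := measure_compl_pow_le (mA₁.preimage measurable_prodMk_left) hcon' L
    have h2 : ((μ.map fV).prod pB) {w | (s, w.1) ∉ A₁} = (μ.map fV) {v | (s, v) ∈ A₁}ᶜ := by
      have h3 : {w : V × Fin B | (s, w.1) ∉ A₁} = {v | (s, v) ∈ A₁}ᶜ ×ˢ Set.univ := by
        ext w; simp
      rw [h3, Measure.prod_prod, measure_univ, mul_one]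
    rw [h2] at hs'
    exact h1.not_gt hs'
  have hfit₂ : ∀ q ∈ {q : S × (V × Fin B) | (q.1, q.2.1) ∈ A₁},
      volume {x | (q, x) ∉ r ⁻¹' A₂} ^ K
        ≤ ENNReal.ofReal (Real.exp (-(K * Real.exp (-c₂) / 2))) := by
    intro q hq
    have mT : MeasurableSet {u | ((q.1, q.2.1), u) ∈ A₂} := mA₂.preimage measurable_prodMk_left
    refine measure_compl_pow_le (π := volume) (A := {x | g q.2.1 x ∈ {u | ((q.1, q.2.1), u) ∈ A₂}})
      (mT.preimage (hgv q.2.1)) (c := c₂) ?_ K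
    rw [hvol q.2.1 mT]
    exact hq.2
  have hd₁ : ∀ y b, ((μ.map fV).prod pB)
      {w | (w, y) ∈ {q : (V × Fin B) × Y | (q.1.1, q.2) ∈ D₁} ∧ w.2 = b}
      ≤ ENNReal.ofReal (Real.exp (-b₁)) * (B : ℝ≥0∞)⁻¹ := by
    intro y b
    have h3 : {w : V × Fin B | (w, y) ∈ {q : (V × Fin B) × Y | (q.1.1, q.2) ∈ D₁} ∧ w.2 = b}
        = {v | (v, y) ∈ D₁} ×ˢ {b} := by
      ext w; rfl
    have h4 : pB {b} = (B : ℝ≥0∞)⁻¹ := by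
      rw [PMF.toMeasure_apply_singleton _ _ (measurableSet_singleton b)]
      simp
    rw [h3, Measure.prod_prod, h4]
    gcongr
    by_cases hy : y ∈ G₁
    · refine le_ofReal_exp_neg (le_trans ?_ hy)
      gcongr
      exact fun hv => hv.1
    · have : {v | (v, y) ∈ D₁} = ∅ := by
        ext v
        exact iff_of_false (fun h => hy h.2) (fun h => h)
      simp [this]
  have hd₂ : ∀ w y, volume {x | ((w, x), y) ∈ {q : ((V × Fin B) × unitInterval) × Y |
      ((q.1.1.1, g q.1.1.1 q.1.2), q.2) ∈ D₂}} ≤ ENNReal.ofReal (Real.exp (-b₂)) := by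
    intro w y
    have mT : MeasurableSet {u | ((w.1, u), y) ∈ D₂} := mD₂.preimage (by fun_prop)
    have h1 := hvol w.1 mT
    change volume {x | g w.1 x ∈ {u | ((w.1, u), y) ∈ D₂}} ≤ _
    rw [h1]
    by_cases hy : (y, w.1) ∈ G₂
    · refine le_ofReal_exp_neg (le_trans ?_ hy)
      gcongr
      exact fun hu => hu.1
    · have : {u | ((w.1, u), y) ∈ D₂} = ∅ := by
        ext u
        exact iff_of_false (fun h => hy h.2) (fun h => h)
      simp [this]
  obtain ⟨f, e, φ, hf, he, hφ, herr⟩ := exists_code_of_sets (L := L) (K := K) (M := M) (B := B)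
    (A₁ := {q : S × (V × Fin B) | (q.1, q.2.1) ∈ A₁}) (A₂ := r ⁻¹' A₂)
    (D₁ := {q : (V × Fin B) × Y | (q.1.1, q.2) ∈ D₁})
    (D₂ := {q : ((V × Fin B) × unitInterval) × Y | ((q.1.1.1, g q.1.1.1 q.1.2), q.2) ∈ D₂})
    (β := Prod.snd) (mA₁.preimage (by fun_prop)) (mr mA₂) (mD₁.preimage (by fun_prop))
    (mD₂.preimage (by fun_prop)) measurable_snd (N.comap r mr) (κX.comap r mr) W
    (fun z F hF => by
      rw [Kernel.comap_apply, Kernel.comap_apply, hN, inputAveraged_apply _ _ _ hF])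
    (μ.map fS) ((μ.map fV).prod pB) volume
    (δ := δ) (ε₀ := 2 * μ {ω | (fS ω, fV ω) ∉ A₁})
    (ε₁ := ENNReal.ofReal (Real.exp (-(L * Real.exp (-c₁) / 2))))
    (ε₂ := ENNReal.ofReal (Real.exp (-(K * Real.exp (-c₂) / 2))))
    (d₁ := ENNReal.ofReal (Real.exp (-b₁)) * (B : ℝ≥0∞)⁻¹)
    (d₂ := ENNReal.ofReal (Real.exp (-b₂)))
    (fun z hz => hz.2) hfit₁ hfit₂ hd₁ hd₂
  refine ⟨f, e, φ, hf, he, hφ, herr.trans ?_⟩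
  gcongr
  exact hPA₁.trans (by gcongr)

end OneShot

/-! ### Diagonal argument, real thresholds and code rates. -/

section Asymptotics

/-- A diagonal argument: codes that are good up to any `ε` eventually give a sequence of codes
that is eventually good up to every `ε`. -/
lemma exists_seq_of_forall_eventually_exists {C : ℕ → Type*} [∀ n, Nonempty (C n)]
    {p : ∀ n, C n → ℝ → Prop} (hmono : ∀ n c ε ε', ε ≤ ε' → p n c ε → p n c ε')
    (h : ∀ ε > 0, ∀ᶠ n in atTop, ∃ c, p n c ε) :
    ∃ c : ∀ n, C n, ∀ ε > 0, ∀ᶠ n in atTop, p n (c n) ε := by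
  classical
  -- At length `n` the code attains the best accuracy `1 / (j + 1)` available with `j ≤ n`.
  let P : ℕ → ℕ → Prop := fun n j => ∃ c, p n c (1 / (j + 1))
  have hc : ∀ n, ∃ c, P n (Nat.findGreatest (P n) n) →
      p n c (1 / ((Nat.findGreatest (P n) n : ℕ) + 1)) := by
    intro n
    by_cases hn : P n (Nat.findGreatest (P n) n)
    · exact hn.imp fun c hc _ => hc
    · exact ⟨Classical.arbitrary _, fun h => absurd h hn⟩
  choose c hc using hc
  refine ⟨c, fun ε hε => ?_⟩
  obtain ⟨j, hj⟩ := exists_nat_one_div_lt hε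
  filter_upwards [h (1 / (j + 1)) (by positivity), eventually_ge_atTop j] with n hn hjn
  refine hmono n _ _ _ ?_ (hc n (Nat.findGreatest_spec hjn hn))
  refine le_trans ?_ hj.le
  refine one_div_le_one_div_of_le (by positivity) ?_
  have : j ≤ Nat.findGreatest (P n) n := Nat.le_findGreatest hjn hn
  have : (j : ℝ) ≤ (Nat.findGreatest (P n) n : ℕ) := by exact_mod_cast this
  linarith

lemma tendsto_exp_neg_mul_exp {γ c : ℝ} (hγ : 0 < γ) (hc : 0 < c) :
    Tendsto (fun n : ℕ => ENNReal.ofReal (Real.exp (-(Real.exp (n * γ) * c)))) atTop (𝓝 0) := by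
  rw [← ENNReal.ofReal_zero]
  refine ENNReal.tendsto_ofReal (Real.tendsto_exp_neg_atTop_nhds_zero.comp ?_)
  refine Tendsto.atTop_mul_const hc (Real.tendsto_exp_atTop.comp ?_)
  exact tendsto_natCast_atTop_atTop.atTop_mul_const hγ

variable {Ω : ℕ → Type*} [∀ n, MeasurableSpace (Ω n)] {μ : ∀ n, Measure (Ω n)}
  {D : ∀ n, Ω n → EReal}

lemma tendsto_le_of_lt_pLiminf_rate {a : ℝ} (h : (a : EReal) < pLiminf μ (rate D)) :
    Tendsto (fun n => μ n {ω | D n ω ≤ ((n * a : ℝ) : EReal)}) atTop (𝓝 0) := by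
  obtain ⟨b, hab, hb⟩ := EReal.lt_iff_exists_real_btwn.1 h
  refine tendsto_of_tendsto_of_tendsto_of_le_of_le' tendsto_const_nhds
    (tendsto_of_lt_pLiminf_rate hb) (Eventually.of_forall fun _ => zero_le) ?_
  filter_upwards [eventually_gt_atTop 0] with n hn
  refine measure_mono fun ω (hω : D n ω ≤ _) => lt_of_le_of_lt hω ?_
  have hn' : (0 : ℝ) < n := by exact_mod_cast hn
  exact_mod_cast mul_lt_mul_of_pos_left (EReal.coe_lt_coe_iff.1 hab) hn'

/-- If `x = ⊥` or `y = ⊤`, one threshold is free and can be tuned to the other. The excluded values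
are those that leave no real threshold on one side. -/
lemma exists_real_of_sub_le {x y : EReal} {r : ℝ} (hx : x ≠ ⊤) (hy : y ≠ ⊥)
    (h : x - y ≤ r) {ε : ℝ} (hε : 0 < ε) :
    ∃ a b : ℝ, x < a ∧ (b : EReal) < y ∧ a - b ≤ r + ε := by
  induction x with
  | top => exact absurd rfl hx
  | bot =>
    obtain ⟨b, -, hb⟩ := EReal.lt_iff_exists_real_btwn.1 (bot_lt_iff_ne_bot.2 hy)
    exact ⟨b + r, b, EReal.bot_lt_coe _, hb, by linarith⟩
  | coe x =>
    induction y with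
    | bot => exact absurd rfl hy
    | top =>
      exact ⟨x + 1, x + 1 - r, by exact_mod_cast lt_add_one x, EReal.coe_lt_top _, by linarith⟩
    | coe y =>
      rw [← EReal.coe_sub, EReal.coe_le_coe_iff] at h
      refine ⟨x + ε / 2, y - ε / 2, ?_, ?_, by linarith⟩
      · exact_mod_cast (by linarith : x < x + ε / 2)
      · exact_mod_cast (by linarith : y - ε / 2 < y)

lemma exists_real_of_le_sub {x y : EReal} {r : ℝ} (hx : x ≠ ⊤)
    (h : (r : EReal) ≤ y - x) {ε : ℝ} (hε : 0 < ε) :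
    ∃ a b : ℝ, x < a ∧ (b : EReal) < y ∧ r - ε ≤ b - a := by
  have hy : y ≠ ⊥ := by
    rintro rfl
    simp at h
  have h' : x - y ≤ ((-r : ℝ) : EReal) := by
    have h1 : x - y = -(y - x) := by
      rw [EReal.neg_sub (Or.inl hy) (Or.inr hx), add_comm, sub_eq_add_neg]
    rw [EReal.coe_neg, h1]
    exact EReal.neg_le_neg_iff.2 h
  obtain ⟨a, b, ha, hb, hab⟩ := exists_real_of_sub_le hx hy h' hε
  exact ⟨a, b, ha, hb, by linarith⟩

lemma coe_le_liminf_rate {M : ℕ → ℕ} {R : ℝ}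
    (h : ∀ ε > 0, ∀ᶠ n : ℕ in atTop, Real.exp (n * (R - ε)) ≤ M n) :
    (R : EReal) ≤ liminf (fun n : ℕ => (((n : ℝ)⁻¹ * Real.log (M n) : ℝ) : EReal)) atTop := by
  refine le_of_forall_lt_real fun a ha => le_liminf_of_le (by isBoundedDefault) ?_
  have ha' : a < R := by exact_mod_cast ha
  filter_upwards [h (R - a) (by linarith), eventually_gt_atTop 0] with n hn hpos
  have hn' : (0 : ℝ) < n := by exact_mod_cast hpos
  rw [EReal.coe_le_coe_iff, inv_mul_eq_div, le_div_iff₀ hn']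
  have := Real.log_le_log (Real.exp_pos _) hn
  rw [Real.log_exp] at this
  linarith

lemma limsup_rate_le_coe {M : ℕ → ℕ} {R : ℝ} (hM : ∀ n, 1 ≤ M n)
    (h : ∀ ε > 0, ∀ᶠ n : ℕ in atTop, M n ≤ Real.exp (n * (R + ε))) :
    limsup (fun n : ℕ => (((n : ℝ)⁻¹ * Real.log (M n) : ℝ) : EReal)) atTop ≤ R := by
  refine EReal.le_of_forall_lt_iff_le.1 fun a ha => limsup_le_of_le (by isBoundedDefault) ?_
  have ha' : R < a := by exact_mod_cast ha
  filter_upwards [h (a - R) (by linarith), eventually_gt_atTop 0] with n hn hpos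
  have hn' : (0 : ℝ) < n := by exact_mod_cast hpos
  have hM' : (0 : ℝ) < M n := by exact_mod_cast hM n
  rw [EReal.coe_le_coe_iff, inv_mul_eq_div, div_le_iff₀ hn']
  have := Real.log_le_log hM' hn
  rw [Real.log_exp] at this
  linarith

end Asymptotics

/-! ### The direct part. -/

section Direct

variable {X S Y : Type*} [MeasurableSpace X] [StandardBorelSpace X] [MeasurableSpace S]
  [StandardBorelSpace S] [Nonempty S] [MeasurableSpace Y] [StandardBorelSpace Y] [Nonempty Y]
  {W : ∀ n : ℕ, Kernel (Vec X n × Vec S n) (Vec Y n)} [∀ n, IsMarkovKernel (W n)]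
  {P : ∀ n : ℕ, Measure (Vec S n)}
  {𝒰 𝒱 : Type*} [MeasurableSpace 𝒰] [StandardBorelSpace 𝒰] [MeasurableSpace 𝒱]

/-- With `L` and `K` about `exp (n * (a₁ + γ))` and `exp (n * (a₂ + γ))` the covering errors are
doubly exponentially small, and a slack of `2 * γ` in `B` and `M` leaves packing errors of order
`exp (-n * γ)`. Nonnegative `a₁` and `a₂` make rounding up cost at most a factor 2. -/
lemma eventually_exists_code (Q : AuxProcess 𝒰 𝒱 W P) {a₁ a₂ b₁ b₂ γ : ℝ} (ha₁ : 0 ≤ a₁)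
    (ha₂ : 0 ≤ a₂) (hγ : 0 < γ)
    (h₁ : supInfo Q.law Q.procV Q.procS < a₁)
    (h₂ : supCondInfo Q.law Q.procU Q.procS Q.procV < a₂)
    (h₃ : (b₁ : EReal) < infInfo Q.law Q.procV Q.procY)
    (h₄ : (b₂ : EReal) < infCondInfo Q.law Q.procU Q.procY Q.procV) :
    ∀ᶠ n : ℕ in atTop, ∃ (M Md : ℕ) (c : Code X S Y n M Md), 1 ≤ M ∧ 1 ≤ Md ∧
      Real.exp (n * (b₂ - a₂ - 2 * γ)) ≤ M ∧ Md ≤ Real.exp (n * (a₁ - b₁ + 2 * γ)) + 1 ∧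
      c.errorProb (W n) (P n) ≤ ENNReal.ofReal γ := by
  set δ : ℝ≥0∞ := ENNReal.ofReal (γ / 2) with hδdef
  have hδ : δ ≠ 0 := by simp [hδdef, hγ]
  have hδ' : δ ≠ ⊤ := ENNReal.ofReal_ne_top
  have t₁ := tendsto_of_pLimsup_rate_lt h₁
  have t₂ := tendsto_of_pLimsup_rate_lt h₂
  have t₃ := tendsto_le_of_lt_pLiminf_rate h₃
  have t₄ := tendsto_le_of_lt_pLiminf_rate h₄
  have t₅ := tendsto_exp_neg_mul_exp hγ (by norm_num : (0 : ℝ) < 1 / 2)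
  have t₆ := tendsto_exp_mul_neg (neg_lt_zero.2 hγ)
  have t₇ := ENNReal.Tendsto.div_const (t₃.add t₄) (b := δ) (Or.inr hδ)
  have t₈ := ENNReal.Tendsto.const_mul (t₁.add (ENNReal.Tendsto.const_mul (t₂.add t₇) (a := 2)
    (Or.inr ENNReal.ofNat_ne_top))) (a := 2) (Or.inr ENNReal.ofNat_ne_top)
  have t₉ := ENNReal.Tendsto.const_mul t₆ (a := 2) (Or.inr ENNReal.ofNat_ne_top)
  -- Every term but `δ` vanishes in the limit, and `δ` is half the allowed error.
  have t := ((((t₈.add t₅).add t₅).add_const δ).add t₉).add t₉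
  simp only [add_zero, ENNReal.zero_div, mul_zero, zero_add] at t
  have hlt : δ < ENNReal.ofReal γ :=
    (ENNReal.ofReal_lt_ofReal_iff hγ).2 (by linarith)
  filter_upwards [t.eventually_lt_const hlt] with n hn
  set L := ⌈Real.exp (n * (a₁ + γ))⌉₊ with hL
  set K := ⌈Real.exp (n * (a₂ + γ))⌉₊ with hK
  -- This `M` is at least the exponential while `M - 1`, which enters the error bound, is at most
  -- it. A negative exponent is harmless: for `n > 0` it gives `M = 1` and no competing message.
  set M := ⌊Real.exp (n * (b₂ - a₂ - 2 * γ))⌋₊ + 1 with hM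
  set B := ⌊Real.exp (n * (a₁ - b₁ + 2 * γ))⌋₊ + 1 with hB
  have : NeZero L := ⟨(Nat.ceil_pos.2 (Real.exp_pos _)).ne'⟩
  have : NeZero K := ⟨(Nat.ceil_pos.2 (Real.exp_pos _)).ne'⟩
  obtain ⟨f, e, φ, hf, he, hφ, herr⟩ := exists_code_of_joint (W n) (Q.markov n)
    (n * a₁) (n * a₂) (n * b₁) (n * b₂) hδ hδ' L K M B
  rw [Q.state_law n] at herr
  refine ⟨M, B, ⟨f, hf, e, he, φ, hφ⟩, by omega, by omega, ?_, ?_, ?_⟩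
  · rw [hM]
    push_cast
    exact (Nat.lt_floor_add_one _).le
  · rw [hB]
    push_cast
    gcongr
    exact Nat.floor_le (Real.exp_pos _).le
  · refine le_trans (herr.trans ?_) hn.le
    have hceil {a : ℝ} (ha : 0 ≤ a) : (⌈Real.exp (n * (a + γ))⌉₊ : ℝ)
        ≤ 2 * Real.exp (n * (a + γ)) := by
      have h1 := (Nat.ceil_lt_add_one (Real.exp_pos (n * (a + γ))).le).le
      have h2 : 1 ≤ Real.exp (n * (a + γ)) := Real.one_le_exp (by positivity)
      linarith
    have hcov {a : ℝ} : ENNReal.ofReal (Real.exp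
        (-((⌈Real.exp (n * (a + γ))⌉₊ : ℝ) * Real.exp (-(n * a)) / 2)))
        ≤ ENNReal.ofReal (Real.exp (-(Real.exp (n * γ) * (1 / 2)))) := by
      refine ENNReal.ofReal_le_ofReal (Real.exp_le_exp.2 (neg_le_neg ?_))
      have h1 := mul_le_mul_of_nonneg_right (Nat.le_ceil (Real.exp (n * (a + γ))))
        (Real.exp_pos (-(n * a))).le
      rw [← Real.exp_add, show n * (a + γ) + -(n * a) = n * γ by ring] at h1
      linarith
    have e₁ : (L : ℝ≥0∞) * (ENNReal.ofReal (Real.exp (-(n * b₁))) * (B : ℝ≥0∞)⁻¹)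
        ≤ 2 * ENNReal.ofReal (Real.exp (n * -γ)) := by
      have hB' : Real.exp (n * (a₁ - b₁ + 2 * γ)) ≤ B := by
        rw [hB]; push_cast; exact (Nat.lt_floor_add_one _).le
      have hBpos : (0 : ℝ) < B := (Real.exp_pos _).trans_le hB'
      rw [← ENNReal.ofReal_natCast L, ← ENNReal.ofReal_natCast B,
        ← ENNReal.ofReal_inv_of_pos hBpos, ← ENNReal.ofReal_mul (by positivity),
        ← ENNReal.ofReal_mul (by positivity), ← ENNReal.ofReal_ofNat,
        ← ENNReal.ofReal_mul (by positivity)]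
      refine ENNReal.ofReal_le_ofReal ?_
      calc (L : ℝ) * (Real.exp (-(n * b₁)) * (B : ℝ)⁻¹)
          ≤ (2 * Real.exp (n * (a₁ + γ))) * (Real.exp (-(n * b₁))
            * (Real.exp (n * (a₁ - b₁ + 2 * γ)))⁻¹) := by
              gcongr
              exact hceil ha₁
        _ = 2 * Real.exp (n * -γ) := by
              rw [← Real.exp_neg, ← Real.exp_add, mul_assoc, ← Real.exp_add]
              congr 2
              ring
    have e₂ : ((M - 1 : ℕ) * K : ℝ≥0∞) * ENNReal.ofReal (Real.exp (-(n * b₂)))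
        ≤ 2 * ENNReal.ofReal (Real.exp (n * -γ)) := by
      have hM' : ((M - 1 : ℕ) : ℝ) ≤ Real.exp (n * (b₂ - a₂ - 2 * γ)) := by
        rw [hM, Nat.add_sub_cancel]
        exact Nat.floor_le (Real.exp_pos _).le
      rw [← ENNReal.ofReal_natCast (M - 1), ← ENNReal.ofReal_natCast K,
        ← ENNReal.ofReal_mul (by positivity),
        ← ENNReal.ofReal_mul (by positivity), ← ENNReal.ofReal_ofNat,
        ← ENNReal.ofReal_mul (by positivity)]
      refine ENNReal.ofReal_le_ofReal ?_
      calc ((M - 1 : ℕ) : ℝ) * (K : ℝ) * Real.exp (-(n * b₂))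
          ≤ Real.exp (n * (b₂ - a₂ - 2 * γ)) * (2 * Real.exp (n * (a₂ + γ)))
            * Real.exp (-(n * b₂)) := by
              gcongr
              exact hceil ha₂
        _ = 2 * Real.exp (n * -γ) := by
              rw [mul_left_comm, mul_assoc, ← Real.exp_add, ← Real.exp_add]
              congr 2
              ring
    exact add_le_add (add_le_add (add_le_add (add_le_add (add_le_add le_rfl hcov) hcov) le_rfl)
      e₁) e₂

omit [∀ n, IsMarkovKernel (W n)] [StandardBorelSpace X] [StandardBorelSpace 𝒰]
  [StandardBorelSpace S] [Nonempty S] [StandardBorelSpace Y] [Nonempty Y] in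
lemma zero_le_supInfo (Q : AuxProcess 𝒰 𝒱 W P) : 0 ≤ supInfo Q.law Q.procV Q.procS := by
  have hV (n) : Measurable (Q.procV n) := measurable_snd.comp (measurable_fst.comp measurable_fst)
  have hS (n) : Measurable (Q.procS n) := measurable_snd.comp (measurable_snd.comp measurable_fst)
  have _ (n) := Measure.isProbabilityMeasure_map (μ := Q.law n) (hV n).aemeasurable
  have _ (n) := Measure.isProbabilityMeasure_map (μ := Q.law n) (hS n).aemeasurable
  exact zero_le_pLimsup_logRatio (fun n => (hV n).prodMk (hS n)) _

omit [∀ n, IsMarkovKernel (W n)] [StandardBorelSpace X] [StandardBorelSpace 𝒰]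
  [StandardBorelSpace S] [Nonempty S] [StandardBorelSpace Y] [Nonempty Y] in
lemma zero_le_infInfo (Q : AuxProcess 𝒰 𝒱 W P) : 0 ≤ infInfo Q.law Q.procV Q.procY := by
  have hV (n) : Measurable (Q.procV n) := measurable_snd.comp (measurable_fst.comp measurable_fst)
  have hY (n) : Measurable (Q.procY n) := measurable_snd
  have _ (n) := Measure.isProbabilityMeasure_map (μ := Q.law n) (hV n).aemeasurable
  have _ (n) := Measure.isProbabilityMeasure_map (μ := Q.law n) (hY n).aemeasurable
  exact zero_le_pLiminf_logRatio (fun n => (hV n).prodMk (hY n)) _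

omit [∀ n, IsMarkovKernel (W n)] [StandardBorelSpace X] [StandardBorelSpace 𝒰]
  [StandardBorelSpace Y] [Nonempty Y] in
lemma zero_le_supCondInfo (Q : AuxProcess 𝒰 𝒱 W P) :
    0 ≤ supCondInfo Q.law Q.procU Q.procS Q.procV := by
  have hU (n) : Measurable (Q.procU n) := measurable_fst.comp (measurable_fst.comp measurable_fst)
  have hV (n) : Measurable (Q.procV n) := measurable_snd.comp (measurable_fst.comp measurable_fst)
  have hS (n) : Measurable (Q.procS n) := measurable_snd.comp (measurable_snd.comp measurable_fst)
  have _ (n) := Measure.isProbabilityMeasure_map (μ := Q.law n) ((hU n).prodMk (hV n)).aemeasurable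
  exact zero_le_pLimsup_logRatio (fun n => ((hU n).prodMk (hV n)).prodMk (hS n)) _

-- Nonemptiness of the input alphabet is not assumed; the law of the process supplies an input
-- vector. These trivial codes serve the lengths at which no good code is at hand.
omit [∀ n, IsMarkovKernel (W n)] [StandardBorelSpace X] [StandardBorelSpace 𝒰]
  [StandardBorelSpace S] [Nonempty S] [StandardBorelSpace Y] [Nonempty Y] in
lemma nonempty_code (Q : AuxProcess 𝒰 𝒱 W P) (n : ℕ) : Nonempty (Code X S Y n 1 1) := by
  obtain ⟨ω⟩ := nonempty_of_isProbabilityMeasure (Q.law n)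
  exact ⟨⟨fun _ => 0, measurable_const, Kernel.const _ (Measure.dirac ω.1.2.1), inferInstance,
    fun _ => 0, measurable_const⟩⟩

/-- **Direct part.** -/
theorem infoRegion_subset_capacityRegion : infoRegion W P ⊆ capacityRegion W P := by
  rintro ⟨R, Rd⟩ ⟨hR, hRd, 𝒰, 𝒱, _, _, _, _, Q, hUS, hVS, h₁, h₂⟩
  simp only at hR hRd h₁ h₂
  let C : ℕ → Type _ := fun n =>
    {q : Σ M : ℕ, Σ Md : ℕ, Code X S Y n M Md // 1 ≤ q.1 ∧ 1 ≤ q.2.1}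
  have : ∀ n, Nonempty (C n) := fun n => ⟨⟨⟨1, 1, (nonempty_code Q n).some⟩, le_rfl, le_rfl⟩⟩
  let p : ∀ n, C n → ℝ → Prop := fun n q ε => Real.exp (n * (R - ε)) ≤ q.1.1 ∧
    (q.1.2.1 : ℝ) ≤ Real.exp (n * (Rd + ε)) ∧ q.1.2.2.errorProb (W n) (P n) ≤ ENNReal.ofReal ε
  have hmono : ∀ n c ε ε', ε ≤ ε' → p n c ε → p n c ε' := by
    rintro n c ε ε' hε ⟨h1, h2, h3⟩
    refine ⟨le_trans ?_ h1, h2.trans ?_, h3.trans (ENNReal.ofReal_le_ofReal hε)⟩ <;> gcongr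
  have hex : ∀ ε > 0, ∀ᶠ n in atTop, ∃ c, p n c ε := by
    intro ε hε
    have hbot : infInfo Q.law Q.procV Q.procY ≠ ⊥ :=
      ne_bot_of_le_ne_bot (by simp) (zero_le_infInfo Q)
    obtain ⟨a₁, b₁, ha₁, hb₁, hab₁⟩ := exists_real_of_sub_le hVS hbot h₂ (by positivity : 0 < ε / 4)
    obtain ⟨a₂, b₂, ha₂, hb₂, hab₂⟩ := exists_real_of_le_sub hUS h₁ (by positivity : 0 < ε / 4)
    have ha₁' : 0 ≤ a₁ := by exact_mod_cast (zero_le_supInfo Q).trans ha₁.le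
    have ha₂' : 0 ≤ a₂ := by exact_mod_cast (zero_le_supCondInfo Q).trans ha₂.le
    -- The last quarter of `ε` absorbs the `+ 1` from rounding the number of bins, which at most
    -- doubles the exponential because `Rd ≥ 0`.
    have hbig : ∀ᶠ n : ℕ in atTop, (2 : ℝ) ≤ Real.exp (n * (ε / 4)) := by
      have : Tendsto (fun n : ℕ => Real.exp (n * (ε / 4))) atTop atTop :=
        Real.tendsto_exp_atTop.comp
          (tendsto_natCast_atTop_atTop.atTop_mul_const (by positivity))
      exact this.eventually_ge_atTop 2
    filter_upwards [eventually_exists_code Q ha₁' ha₂' (by positivity : 0 < ε / 4) ha₁ ha₂ hb₁ hb₂,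
      hbig] with n hn hbig
    obtain ⟨M, Md, c, hM, hMd, hM', hMd', herr⟩ := hn
    refine ⟨⟨⟨M, Md, c⟩, hM, hMd⟩, le_trans ?_ hM', hMd'.trans ?_, herr.trans ?_⟩
    · refine Real.exp_le_exp.2 (mul_le_mul_of_nonneg_left ?_ n.cast_nonneg)
      linarith
    · have h1 : Real.exp (n * (a₁ - b₁ + 2 * (ε / 4))) ≤ Real.exp (n * (Rd + 3 * (ε / 4))) := by
        refine Real.exp_le_exp.2 (mul_le_mul_of_nonneg_left ?_ n.cast_nonneg)
        linarith
      have h2 : 1 ≤ Real.exp (n * (Rd + 3 * (ε / 4))) := Real.one_le_exp (by positivity)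
      calc _ ≤ Real.exp (n * (ε / 4)) * Real.exp (n * (Rd + 3 * (ε / 4))) := by nlinarith
        _ = _ := by
          rw [← Real.exp_add]
          congr 1
          ring
    · exact ENNReal.ofReal_le_ofReal (by linarith)
  obtain ⟨c, hc⟩ := exists_seq_of_forall_eventually_exists hmono hex
  refine ⟨hR, hRd, fun n => (c n).1.1, fun n => (c n).1.2.1, fun n => (c n).1.2.2,
    fun n => (c n).2.1, fun n => (c n).2.2,
    coe_le_liminf_rate fun ε hε => (hc ε hε).mono fun n h => h.1,
    limsup_rate_le_coe (fun n => (c n).2.2) fun ε hε => (hc ε hε).mono fun n h => h.2.1, ?_⟩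
  refine ENNReal.tendsto_nhds_zero.2 fun ε hε => ?_
  by_cases htop : ε = ⊤
  · simp [htop]
  · filter_upwards [hc ε.toReal (ENNReal.toReal_pos hε.ne' htop)] with n hn
    exact hn.2.2.trans (ENNReal.ofReal_toReal htop).le

end Direct

/-! ### Bounds on information densities for the converse. -/

section ConverseBounds

variable {Ω α β γ : Type*} [MeasurableSpace Ω] [MeasurableSpace α] [MeasurableSpace β]
  [MeasurableSpace γ] {μ : Measure Ω} [IsProbabilityMeasure μ] {A : Ω → α} {B : Ω → β} {C : Ω → γ}

/-- The information density between a variable with `k` values and any other variable exceeds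
`c` with probability at most `k exp (-c)`. -/
lemma measure_lt_infoDensity_le [MeasurableSingletonClass α] (hA : Measurable A)
    (hB : Measurable B) {k : ℕ} (ι : Fin k → α) (hι : ∀ᵐ ω ∂μ, ∃ d, A ω = ι d) (c : ℝ) :
    μ {ω | (c : EReal) < infoDensity μ A B ω} ≤ k * ENNReal.ofReal (Real.exp (-c)) := by
  have := Measure.isProbabilityMeasure_map (μ := μ) hA.aemeasurable
  have := Measure.isProbabilityMeasure_map (μ := μ) hB.aemeasurable
  have := Measure.isProbabilityMeasure_map (μ := μ) (hA.prodMk hB).aemeasurable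
  set E : Set (α × β) := {q | (c : EReal) < logRatio (μ.map fun ω => (A ω, B ω))
    ((μ.map A).prod (μ.map B)) q} with hE
  have mE : MeasurableSet E := measurableSet_lt measurable_const (measurable_logRatio _ _)
  have hd (d : Fin k) : μ {ω | (A ω, B ω) ∈ E ∧ A ω = ι d} ≤ ENNReal.ofReal (Real.exp (-c)) := by
    set T : Set β := {b | (ι d, b) ∈ E}
    have mT : MeasurableSet T := mE.preimage measurable_prodMk_left
    have hR : MeasurableSet ({ι d} ×ˢ T) := (measurableSet_singleton _).prod mT
    have h1 := mul_measure_le_of_lt_logRatio (P := μ.map fun ω => (A ω, B ω))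
      (Q := (μ.map A).prod (μ.map B)) hR (c := c) (by
        rintro ⟨a, b⟩ ⟨ha, hb⟩
        have ha' : a = ι d := ha
        rw [ha']
        exact hb)
    have h2 : μ {ω | (A ω, B ω) ∈ E ∧ A ω = ι d} = (μ.map fun ω => (A ω, B ω)) ({ι d} ×ˢ T) := by
      rw [Measure.map_apply (hA.prodMk hB) hR]
      congr 1
      ext ω
      constructor
      · rintro ⟨h3, h4⟩
        refine ⟨h4, ?_⟩
        change (ι d, B ω) ∈ E
        rwa [← h4]
      · rintro ⟨h3, h4⟩
        have h5 : A ω = ι d := h3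
        refine ⟨?_, h5⟩
        rw [h5]
        exact h4
    rw [Measure.prod_prod, ← h2] at h1
    set p := μ {ω | (A ω, B ω) ∈ E ∧ A ω = ι d}
    -- Both marginal probabilities are at least `p`, so `h1` becomes `exp c * p ^ 2 ≤ p`.
    have hpA : p ≤ (μ.map A) {ι d} := by
      rw [Measure.map_apply hA (measurableSet_singleton _)]
      exact measure_mono fun ω hω => hω.2
    have hpB : p ≤ (μ.map B) T := by
      rw [Measure.map_apply hB mT]
      refine measure_mono fun ω hω => ?_
      change (ι d, B ω) ∈ E
      rw [← hω.2]
      exact hω.1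
    by_cases hp : p = 0
    · rw [hp]; exact zero_le
    refine le_ofReal_exp_neg ?_
    have h3 : (ENNReal.ofReal (Real.exp c) * p) * p ≤ 1 * p := by
      rw [one_mul]
      refine le_trans ?_ h1
      rw [mul_assoc]
      gcongr
    exact (ENNReal.mul_le_mul_iff_left hp (measure_ne_top _ _)).1 h3
  calc μ {ω | (c : EReal) < infoDensity μ A B ω}
      ≤ μ (⋃ d, {ω | (A ω, B ω) ∈ E ∧ A ω = ι d}) := by
        refine measure_mono_ae ?_
        filter_upwards [hι] with ω ⟨d, hd⟩ hω
        exact Set.mem_iUnion.2 ⟨d, hω, hd⟩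
    _ ≤ ∑ d, μ {ω | (A ω, B ω) ∈ E ∧ A ω = ι d} := measure_iUnion_fintype_le _ _
    _ ≤ ∑ _ : Fin k, ENNReal.ofReal (Real.exp (-c)) := Finset.sum_le_sum fun d _ => hd d
    _ = _ := by simp

variable [StandardBorelSpace β] [Nonempty β]

/-- As `A` is independent of `C`, the coupling that is conditionally independent given `C` makes `A`
independent of the pair `(C, B)`. -/
lemma compProd_condDistrib_of_indepFun (hA : Measurable A) (hB : Measurable B) (hC : Measurable C)
    (h : IndepFun A C μ) :
    (μ.map fun ω => (A ω, C ω)) ⊗ₘ (Kernel.prodMkLeft α (condDistrib B C μ))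
      = ((μ.map A).prod (μ.map fun ω => (C ω, B ω))).map fun q => ((q.1, q.2.1), q.2.2) := by
  have := Measure.isProbabilityMeasure_map (μ := μ) hA.aemeasurable
  have := Measure.isProbabilityMeasure_map (μ := μ) hC.aemeasurable
  have := Measure.isProbabilityMeasure_map (μ := μ) (hC.prodMk hB).aemeasurable
  have he : Measurable fun q : α × γ × β => ((q.1, q.2.1), q.2.2) := by fun_prop
  rw [(indepFun_iff_map_prod_eq_prod_map_map hA.aemeasurable hC.aemeasurable).1 h]
  ext E hE
  rw [Measure.map_apply he hE, Measure.compProd_apply hE, Measure.prod_apply (he hE),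
    lintegral_prod _ (Kernel.measurable_kernel_prodMk_left hE).aemeasurable]
  refine lintegral_congr fun a => ?_
  rw [← compProd_map_condDistrib hB.aemeasurable,
    Measure.compProd_apply (measurable_prodMk_left (he hE))]
  rfl

/-- If `A` is independent of `(C, B)`, the conditional information density vanishes. -/
lemma measure_lt_condInfoDensity_eq_zero (hA : Measurable A) (hB : Measurable B)
    (hC : Measurable C) (h : IndepFun A (fun ω => (C ω, B ω)) μ) {c : ℝ} (hc : 0 < c) :
    μ {ω | (c : EReal) < condInfoDensity μ A B C ω} = 0 := by
  have hAC : IndepFun A C μ := h.comp measurable_id measurable_fst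
  have := Measure.isProbabilityMeasure_map (μ := μ) ((hA.prodMk hC).prodMk hB).aemeasurable
  have heq : (μ.map fun ω => (A ω, C ω)) ⊗ₘ (Kernel.prodMkLeft α (condDistrib B C μ))
      = μ.map fun ω => ((A ω, C ω), B ω) := by
    rw [compProd_condDistrib_of_indepFun hA hB hC hAC,
      ← (indepFun_iff_map_prod_eq_prod_map_map hA.aemeasurable (hC.prodMk hB).aemeasurable).1 h,
      Measure.map_map (by fun_prop) (by fun_prop)]
    rfl
  have h0 := measure_lt_logRatio_self (P := μ.map fun ω => ((A ω, C ω), B ω)) hc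
  rw [Measure.map_apply ((hA.prodMk hC).prodMk hB)
    (measurableSet_lt measurable_const (measurable_logRatio _ _))] at h0
  simp only [condInfoDensity, heq]
  exact h0

/-- The Verdú-Han bound: a small information density makes an error likely. -/
lemma measure_condInfoDensity_lt_le [Countable α] [MeasurableSingletonClass α]
    (hA : Measurable A) (hB : Measurable B)
    (hC : Measurable C) (h : IndepFun A C μ) {g : β × γ → α} (hg : Measurable g) {p : ℝ≥0∞}
    (hp : ∀ a, (μ.map A) {a} ≤ p) (c : ℝ) :
    μ {ω | condInfoDensity μ A B C ω < c}
      ≤ μ {ω | g (B ω, C ω) ≠ A ω} + ENNReal.ofReal (Real.exp c) * p := by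
  have := Measure.isProbabilityMeasure_map (μ := μ) hA.aemeasurable
  have := Measure.isProbabilityMeasure_map (μ := μ) (hA.prodMk hC).aemeasurable
  have := Measure.isProbabilityMeasure_map (μ := μ) (hC.prodMk hB).aemeasurable
  have := Measure.isProbabilityMeasure_map (μ := μ) ((hA.prodMk hC).prodMk hB).aemeasurable
  set Q := (μ.map fun ω => (A ω, C ω)) ⊗ₘ (Kernel.prodMkLeft α (condDistrib B C μ)) with hQ
  set E : Set ((α × γ) × β) := {q | logRatio (μ.map fun ω => ((A ω, C ω), B ω)) Q q ≤ c}
  have mE : MeasurableSet E := measurableSet_le (measurable_logRatio _ _) measurable_const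
  set G : Set ((α × γ) × β) := {q | g (q.2, q.1.2) = q.1.1}
  have mG : MeasurableSet G := measurableSet_eq_fun (by fun_prop) (by fun_prop)
  -- Under `Q` the pair `(C, B)` says nothing about `A`, so a guess is right with at most the
  -- probability of the largest atom.
  have hQG : Q G ≤ p := by
    rw [hQ, compProd_condDistrib_of_indepFun hA hB hC h, Measure.map_apply (by fun_prop) mG,
      Measure.prod_apply_symm (mG.preimage (by fun_prop))]
    have := Measure.isProbabilityMeasure_map (μ := μ) (hC.prodMk hB).aemeasurable
    refine lintegral_le_of_forall_le fun q => le_trans (measure_mono ?_) (hp (g (q.2, q.1)))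
    intro a ha
    have ha' : g (q.2, q.1) = a := ha
    exact ha'.symm
  have h1 := measure_le_mul_of_logRatio_le (P := μ.map fun ω => ((A ω, C ω), B ω)) (Q := Q)
    (mE.inter mG) (c := c) fun q hq => hq.1
  rw [Measure.map_apply ((hA.prodMk hC).prodMk hB) (mE.inter mG)] at h1
  calc μ {ω | condInfoDensity μ A B C ω < c}
      ≤ μ {ω | g (B ω, C ω) ≠ A ω} + μ ((fun ω => ((A ω, C ω), B ω)) ⁻¹' (E ∩ G)) := by
        refine le_trans (measure_mono fun ω hω => ?_) (measure_union_le _ _)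
        by_cases hd : g (B ω, C ω) = A ω
        · refine Or.inr ⟨?_, hd⟩
          have : condInfoDensity μ A B C ω < c := hω
          exact this.le
        · exact Or.inl hd
    _ ≤ _ := by
        refine add_le_add_right (h1.trans ?_) _
        gcongr
        exact (measure_mono Set.inter_subset_right).trans hQG

end ConverseBounds

/-! ### The joint law induced by a code. -/

section CodeLaw

variable {X S Y : Type*} [MeasurableSpace X] [MeasurableSpace S] [MeasurableSpace Y]

/-- An index as a constant vector of natural numbers. -/
def constVec (n : ℕ) {k : ℕ} (d : Fin k) : Vec ℕ n := fun _ => d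

lemma constVec_injective {n k : ℕ} (hn : 0 < n) : Function.Injective (constVec n (k := k)) :=
  fun _ _ h => Fin.ext (congrFun h ⟨0, hn⟩)

variable {n M Md : ℕ} [NeZero M]

/-- The uniform distribution of the message. -/
def msgLaw (M : ℕ) [NeZero M] : Measure (Fin M) := (PMF.uniformOfFintype (Fin M)).toMeasure

instance : IsProbabilityMeasure (msgLaw M) := by unfold msgLaw; infer_instance

lemma msgLaw_singleton (m : Fin M) : msgLaw M {m} = (M : ℝ≥0∞)⁻¹ := by
  rw [msgLaw, PMF.toMeasure_apply_singleton _ _ (measurableSet_singleton m)]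
  simp

/-- The law of message, state description, input and state when a code is used. -/
def Code.inputLaw (c : Code X S Y n M Md) (P : Measure (Vec S n)) :
    Measure ((Vec ℕ n × Vec ℕ n) × (Vec X n × Vec S n)) :=
  (((msgLaw M).prod P) ⊗ₘ c.enc).map
    fun q => ((constVec n q.1.1, constVec n (c.stateEnc q.1.2)), (q.2, q.1.2))

/-- The joint law of message, state description, input, state and output when a code is used. -/
def Code.jointLaw (c : Code X S Y n M Md) (W : Kernel (Vec X n × Vec S n) (Vec Y n))
    (P : Measure (Vec S n)) : Measure (Joint ℕ ℕ X S Y n) :=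
  c.inputLaw P ⊗ₘ Kernel.prodMkLeft (Vec ℕ n × Vec ℕ n) W

variable (c : Code X S Y n M Md) (W : Kernel (Vec X n × Vec S n) (Vec Y n)) [IsMarkovKernel W]
  (P : Measure (Vec S n)) [IsProbabilityMeasure P]

omit [NeZero M] in
lemma Code.measurable_inputMap : Measurable fun q : (Fin M × Vec S n) × Vec X n =>
    ((constVec n q.1.1, constVec n (c.stateEnc q.1.2)), (q.2, q.1.2)) := by
  have h1 : Measurable (constVec n (k := M)) := measurable_of_countable _
  have h2 : Measurable (constVec n (k := Md)) := measurable_of_countable _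
  have h3 := c.measurable_stateEnc
  fun_prop

instance : IsProbabilityMeasure (c.inputLaw P) := by
  have := c.isMarkovKernel_enc
  exact Measure.isProbabilityMeasure_map c.measurable_inputMap.aemeasurable

instance : IsProbabilityMeasure (c.jointLaw W P) := by
  unfold Code.jointLaw; infer_instance

lemma Code.fst_jointLaw : (c.jointLaw W P).fst = c.inputLaw P := Measure.fst_compProd _ _

lemma Code.jointLaw_map_comp_fst {α : Type*} [MeasurableSpace α]
    {f : (Vec ℕ n × Vec ℕ n) × (Vec X n × Vec S n) → α} (hf : Measurable f) :
    (c.jointLaw W P).map (fun ω => f ω.1) = (c.inputLaw P).map f := by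
  rw [← c.fst_jointLaw W P, Measure.fst, Measure.map_map hf measurable_fst]
  rfl

/-- Integrating out output and input leaves the independent pair of message and state, and the
description is a function of the state. The product form yields the independence of `U` and `(V,
S)`. -/
lemma Code.jointLaw_map_index : (c.jointLaw W P).map (fun ω => (ω.1.1.1, (ω.1.1.2, ω.1.2.2)))
    = ((msgLaw M).map (constVec n)).prod (P.map fun s => (constVec n (c.stateEnc s), s)) := by
  have := c.isMarkovKernel_enc
  have h1 : Measurable (constVec n (k := M)) := measurable_of_countable _
  have h2 : Measurable (constVec n (k := Md)) := measurable_of_countable _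
  have h3 := c.measurable_stateEnc
  rw [c.jointLaw_map_comp_fst W P (f := fun q => (q.1.1, (q.1.2, q.2.2))) (by fun_prop),
    Code.inputLaw, Measure.map_map (by fun_prop) c.measurable_inputMap,
    Measure.map_prod_map _ _ h1 (by fun_prop)]
  conv_rhs => rw [← Measure.fst_compProd ((msgLaw M).prod P) c.enc, Measure.fst]
  rw [Measure.map_map (by fun_prop) measurable_fst]
  rfl

lemma Code.jointLaw_map_msg : (c.jointLaw W P).map (fun ω => ω.1.1.1)
    = (msgLaw M).map (constVec n) := by
  have h2 : Measurable (constVec n (k := Md)) := measurable_of_countable _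
  have h3 := c.measurable_stateEnc
  have := Measure.isProbabilityMeasure_map (μ := P)
    (f := fun s => (constVec n (c.stateEnc s), s)) (by fun_prop)
  have h := congrArg Measure.fst (c.jointLaw_map_index W P)
  rw [Measure.fst_prod, Measure.fst_map_prodMk (by fun_prop)] at h
  exact h

lemma Code.jointLaw_map_stateEnc : (c.jointLaw W P).map (fun ω => (ω.1.1.2, ω.1.2.2))
    = P.map fun s => (constVec n (c.stateEnc s), s) := by
  have h1 : Measurable (constVec n (k := M)) := measurable_of_countable _
  have := Measure.isProbabilityMeasure_map (μ := msgLaw M) h1.aemeasurable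
  have h2 : Measurable (constVec n (k := Md)) := measurable_of_countable _
  have h3 := c.measurable_stateEnc
  have := Measure.isProbabilityMeasure_map (μ := P)
    (f := fun s => (constVec n (c.stateEnc s), s)) (by fun_prop)
  have h := congrArg Measure.snd (c.jointLaw_map_index W P)
  rw [Measure.snd_prod, Measure.snd_map_prodMk (by fun_prop)] at h
  exact h

lemma Code.jointLaw_map_state : (c.jointLaw W P).map (fun ω => ω.1.2.2) = P := by
  have h2 : Measurable (constVec n (k := Md)) := measurable_of_countable _
  have h3 := c.measurable_stateEnc
  have h := congrArg Measure.snd (c.jointLaw_map_stateEnc W P)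
  rw [Measure.snd_map_prodMk (by fun_prop), Measure.snd_map_prodMk (by fun_prop)] at h
  simpa using h

lemma Code.indepFun_jointLaw : IndepFun (fun ω : Joint ℕ ℕ X S Y n => ω.1.1.1)
    (fun ω => (ω.1.1.2, ω.1.2.2)) (c.jointLaw W P) := by
  rw [indepFun_iff_map_prod_eq_prod_map_map (by fun_prop) (by fun_prop), c.jointLaw_map_msg W P,
    c.jointLaw_map_stateEnc W P]
  exact c.jointLaw_map_index W P

lemma Code.ae_jointLaw_stateEnc :
    ∀ᵐ ω ∂(c.jointLaw W P), ∃ d : Fin Md, ω.1.1.2 = constVec n d := by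
  have h2 : Measurable (constVec n (k := Md)) := measurable_of_countable _
  have h3 := c.measurable_stateEnc
  have hm : MeasurableSet {q : Vec ℕ n × Vec S n | ∃ d : Fin Md, q.1 = constVec n d} := by
    rw [Set.ofPred_exists]
    exact MeasurableSet.iUnion fun d => measurableSet_eq_fun measurable_fst measurable_const
  have h : ∀ᵐ q ∂(c.jointLaw W P).map (fun ω => (ω.1.1.2, ω.1.2.2)),
      ∃ d : Fin Md, q.1 = constVec n d := by
    rw [c.jointLaw_map_stateEnc W P, ae_map_iff (by fun_prop) hm]
    exact Eventually.of_forall fun s => ⟨_, rfl⟩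
  exact ae_of_ae_map (f := fun ω : Joint ℕ ℕ X S Y n => (ω.1.1.2, ω.1.2.2)) (by fun_prop) h

/-- The decoder acting on constant vectors. -/
def Code.vecDec [NeZero Md] (q : Vec Y n × Vec ℕ n) : Vec ℕ n :=
  constVec n (c.dec (q.1, Function.invFun (constVec n) q.2))

omit [NeZero M] in
lemma Code.measurable_vecDec [NeZero Md] : Measurable c.vecDec := by
  have h1 : Measurable (constVec n (k := M)) := measurable_of_countable _
  have h2 : Measurable (Function.invFun (constVec n (k := Md))) := measurable_of_countable _
  have h3 := c.measurable_dec
  exact h1.comp (h3.comp (measurable_fst.prodMk (h2.comp measurable_snd)))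

/-- Constant vectors of positive length determine their index, so `vecDec` errs exactly when `dec`
does; all vectors of length `0` coincide. -/
lemma Code.measure_vecDec_ne [NeZero Md] (hn : 0 < n) :
    c.jointLaw W P {ω | c.vecDec (ω.2, ω.1.1.2) ≠ ω.1.1.1} = c.errorProb W P := by
  have := c.isMarkovKernel_enc
  have hA : MeasurableSet {ω : Joint ℕ ℕ X S Y n | c.vecDec (ω.2, ω.1.1.2) ≠ ω.1.1.1} := by
    have := c.measurable_vecDec
    exact (measurableSet_eq_fun (by fun_prop) (by fun_prop)).compl
  have hk := Kernel.measurable_kernel_prodMk_left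
    (κ := Kernel.prodMkLeft (Vec ℕ n × Vec ℕ n) W) hA
  have hk' := hk.comp c.measurable_inputMap
  simp only [Function.comp_def] at hk'
  rw [Code.jointLaw, Measure.compProd_apply hA, Code.inputLaw,
    lintegral_map hk c.measurable_inputMap,
    Measure.lintegral_compProd hk',
    lintegral_prod _ (Measurable.lintegral_kernel_prod_right' hk').aemeasurable,
    lintegral_fintype]
  simp only [msgLaw_singleton, ← Finset.sum_mul]
  rw [mul_comm, Code.errorProb]
  congr 1
  refine Finset.sum_congr rfl fun m _ => lintegral_congr fun s => lintegral_congr fun x => ?_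
  rw [Kernel.prodMkLeft_apply]
  congr 1
  ext y
  simp only [Set.mem_preimage, Set.mem_ofPred_eq, Code.vecDec,
    Function.leftInverse_invFun (constVec_injective hn) _]
  exact (constVec_injective hn).ne_iff

end CodeLaw

/-! ### The converse part. -/

section Converse

variable {X S Y : Type*} [MeasurableSpace X] [MeasurableSpace S]
  [StandardBorelSpace S] [Nonempty S] [MeasurableSpace Y] [StandardBorelSpace Y] [Nonempty Y]
  {W : ∀ n : ℕ, Kernel (Vec X n × Vec S n) (Vec Y n)} [∀ n, IsMarkovKernel (W n)]
  {P : ∀ n : ℕ, Measure (Vec S n)} [∀ n, IsProbabilityMeasure (P n)]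

/-- The auxiliary process of a sequence of codes: `U` is the message, `V` the state description. -/
def auxOfCodes {M Md : ℕ → ℕ} [∀ n, NeZero (M n)] (c : ∀ n, Code X S Y n (M n) (Md n)) :
    AuxProcess ℕ ℕ W P where
  law n := (c n).jointLaw (W n) (P n)
  isProb n := inferInstance
  state_law n := (c n).jointLaw_map_state (W n) (P n)
  markov n := by rw [(c n).fst_jointLaw]; rfl

/-- **Converse part.** -/
theorem capacityRegion_subset_infoRegion : capacityRegion W P ⊆ infoRegion W P := by
  rintro ⟨R, Rd⟩ ⟨hR, hRd, M, Md, c, hM, hMd, hliminf, hlimsup, herr⟩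
  simp only at hR hRd hliminf hlimsup
  have : ∀ n, NeZero (M n) := fun n => ⟨by have := hM n; omega⟩
  have : ∀ n, NeZero (Md n) := fun n => ⟨by have := hMd n; omega⟩
  let Q : AuxProcess ℕ ℕ W P := auxOfCodes c
  have hU (n) : Measurable (Q.procU n) := measurable_fst.comp (measurable_fst.comp measurable_fst)
  have hV (n) : Measurable (Q.procV n) := measurable_snd.comp (measurable_fst.comp measurable_fst)
  have hS (n) : Measurable (Q.procS n) := measurable_snd.comp (measurable_snd.comp measurable_fst)
  have hY (n) : Measurable (Q.procY n) := measurable_snd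
  have hind (n) : IndepFun (Q.procU n) (fun ω => (Q.procV n ω, Q.procS n ω)) (Q.law n) :=
    (c n).indepFun_jointLaw (W n) (P n)
  have h₁ : supCondInfo Q.law Q.procU Q.procS Q.procV ≤ 0 := by
    refine pLimsup_rate_le_of_forall fun a ha => ?_
    have ha' : 0 < a := by exact_mod_cast ha
    refine tendsto_const_nhds.congr' ?_
    filter_upwards [eventually_gt_atTop 0] with n hn
    exact (measure_lt_condInfoDensity_eq_zero (hU n) (hS n) (hV n) (hind n)
      (by positivity)).symm
  -- The description has `Md n` values, eventually fewer than `exp (n * b)` for any `b > Rd`, so a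
  -- density above `n * a` with `a > b` is exponentially unlikely.
  have h₂ : supInfo Q.law Q.procV Q.procS ≤ Rd := by
    refine pLimsup_rate_le_of_forall fun a ha => ?_
    obtain ⟨b, hb, hba⟩ := EReal.lt_iff_exists_real_btwn.1 ha
    have hba' : b < a := by exact_mod_cast hba
    have hev := eventually_lt_of_limsup_lt (hlimsup.trans_lt hb)
    refine tendsto_of_tendsto_of_tendsto_of_le_of_le' tendsto_const_nhds
      (tendsto_exp_mul_neg (sub_neg.2 hba')) (Eventually.of_forall fun _ => zero_le) ?_
    filter_upwards [hev, eventually_gt_atTop 0] with n hn hpos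
    refine (measure_lt_infoDensity_le (hV n) (hS n) (constVec n (k := Md n))
      ((c n).ae_jointLaw_stateEnc (W n) (P n)) (n * a)).trans ?_
    have hn' : (0 : ℝ) < n := by exact_mod_cast hpos
    have hMd' : (0 : ℝ) < Md n := by exact_mod_cast hMd n
    rw [EReal.coe_lt_coe_iff, inv_mul_eq_div, div_lt_iff₀ hn', Real.log_lt_iff_lt_exp hMd'] at hn
    rw [← ENNReal.ofReal_natCast, ← ENNReal.ofReal_mul (by positivity)]
    refine ENNReal.ofReal_le_ofReal ?_
    calc (Md n : ℝ) * Real.exp (-(n * a)) ≤ Real.exp (b * n) * Real.exp (-(n * a)) := by gcongr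
      _ = Real.exp (n * (b - a)) := by rw [← Real.exp_add]; congr 1; ring
  have h₃ : (R : EReal) ≤ infCondInfo Q.law Q.procU Q.procY Q.procV := by
    refine le_pLiminf_rate fun a ha => ?_
    obtain ⟨b, hab, hb⟩ := EReal.lt_iff_exists_real_btwn.1 ha
    have hab' : a < b := by exact_mod_cast hab
    have hev := eventually_lt_of_lt_liminf (hb.trans_le hliminf)
    have ht := herr.add (tendsto_exp_mul_neg (sub_neg.2 hab'))
    rw [add_zero] at ht
    refine tendsto_of_tendsto_of_tendsto_of_le_of_le' tendsto_const_nhds ht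
      (Eventually.of_forall fun _ => zero_le) ?_
    filter_upwards [hev, eventually_gt_atTop 0] with n hn hpos
    -- The message is uniform, so no atom exceeds `1 / M n`; the Verdú-Han bound then adds only `exp
    -- (n * a) / M n` to the error probability.
    have hsing : ∀ u, ((Q.law n).map (Q.procU n)) {u} ≤ (M n : ℝ≥0∞)⁻¹ := by
      intro u
      have h := (c n).jointLaw_map_msg (W n) (P n)
      change ((c n).jointLaw (W n) (P n)).map (fun ω => ω.1.1.1) {u} ≤ _
      rw [h, Measure.map_apply (measurable_of_countable _) (measurableSet_singleton u)]
      by_cases hu : ∃ m : Fin (M n), constVec n m = u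
      · obtain ⟨m, rfl⟩ := hu
        rw [← Set.image_singleton, (constVec_injective hpos).preimage_image, msgLaw_singleton]
      · have : constVec n (k := M n) ⁻¹' {u} = ∅ := by
          ext m
          exact iff_of_false (fun h => hu ⟨m, h⟩) (fun h => h)
        simp [this]
    refine (measure_condInfoDensity_lt_le (hU n) (hY n) (hV n)
      ((hind n).comp measurable_id measurable_fst) (c n).measurable_vecDec hsing (n * a)).trans ?_
    refine add_le_add ((c n).measure_vecDec_ne (W n) (P n) hpos).le ?_
    have hn' : (0 : ℝ) < n := by exact_mod_cast hpos
    have hM' : (0 : ℝ) < M n := by exact_mod_cast hM n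
    rw [EReal.coe_lt_coe_iff, inv_mul_eq_div, lt_div_iff₀ hn', Real.lt_log_iff_exp_lt hM'] at hn
    rw [← ENNReal.ofReal_natCast, ← ENNReal.ofReal_inv_of_pos hM',
      ← ENNReal.ofReal_mul (by positivity)]
    refine ENNReal.ofReal_le_ofReal ?_
    calc Real.exp (n * a) * (M n : ℝ)⁻¹ ≤ Real.exp (n * a) * (Real.exp (b * n))⁻¹ := by gcongr
      _ = Real.exp (n * (a - b)) := by rw [← Real.exp_neg, ← Real.exp_add]; congr 1; ring
  have h₄ : 0 ≤ infInfo Q.law Q.procV Q.procY := zero_le_infInfo Q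
  refine ⟨hR, hRd, ℕ, ℕ, inferInstance, inferInstance, inferInstance, inferInstance, Q,
    ne_top_of_le_ne_top (by simp) h₁, ne_top_of_le_ne_top (EReal.coe_ne_top Rd) h₂, ?_, ?_⟩
  · calc (R : EReal) = R - 0 := by simp
      _ ≤ _ := EReal.sub_le_sub h₃ h₁
  · calc _ ≤ (Rd : EReal) - 0 := EReal.sub_le_sub h₂ h₄
      _ = _ := by simp

end Converse

end GelfandPinsker

end

/-- The capacity region of the general Gel'fand-Pinsker problem with coded state information at
the decoder. -/
theorem theorem2 {X S Y : Type*}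
    [MeasurableSpace X] [StandardBorelSpace X]
    [MeasurableSpace S] [StandardBorelSpace S] [Nonempty S]
    [MeasurableSpace Y] [StandardBorelSpace Y] [Nonempty Y]
    (W : ∀ n : ℕ, Kernel ((Fin n → X) × (Fin n → S)) (Fin n → Y)) [∀ n, IsMarkovKernel (W n)]
    (P : ∀ n : ℕ, Measure (Fin n → S)) [∀ n, IsProbabilityMeasure (P n)] :
    GelfandPinsker.capacityRegion W P = GelfandPinsker.infoRegion W P := by
  exact (GelfandPinsker.capacityRegion_subset_infoRegion).antisymm
    GelfandPinsker.infoRegion_subset_capacityRegion
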